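/- Conventions. All cardinals and ordinals are those of a fixed universe. For a set of ordinals $D$, "function on $D$" means a partial function on the ordinals with domain $D$. Let $\lambda$ be an infinite cardinal and let $\mu$ be a cardinal or $\mu=\infty$ (then "$<\mu$" is no restriction); $[\lambda,\mu)$ is the set of cardinals $\kappa$ with $\lambda\le\kappa<\mu$. A space $X$ is $(<\lambda)$-metrizable if each subspace with fewer than $\lambda$ points is metrizable. $X$ is CWH if for every $Y\subseteq X$ whose subspace topology is discrete there are pairwise disjoint open sets $U_y\ni y$ $(y\in Y)$ of $X$. $X$ is CWN if whenever $(Y_i)_i$ are pairwise disjoint subsets of $X$, each clopen in the subspace $\bigcup_j Y_j$, there are pairwise disjoint open sets $U_i\supseteq Y_i$ of $X$. $X$ is $(<\lambda)$-CWH (resp. $(<\lambda)$-$^*$CWN) if each subspace with fewer than $\lambda$ points is CWH (resp. CWN); $\lambda$-CWH and $\lambda$-$^*$CWN mean $(<\lambda^+)$-CWH and $(<\lambda^+)$-$^*$CWN. A family $H$ of functions from sets of ordinals to $\omega$ is free if there is $g:\mathrm{Ord}\to\omega$ such that for each $h\in H$ there is $\xi<\omega$ with $h(\alpha)\le g(\alpha)$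 or $h(\alpha)\le\xi$ for all $\alpha\in\mathrm{Dom}(h)$. Let $\mathrm{Pic}$ be the set of antichains of $\omega\times\omega$ (coordinatewise order) and $Cl(a)=\{q:\exists p\in a\; p\le q\}$. A family $H$ of functions from sets of ordinals to $\mathrm{Pic}$ is free if there is $g:\mathrm{Ord}\to\omega$ such that for each $h\in H$ there is $\xi<\omega$ with $(g(\alpha),\xi)\in Cl(h(\alpha))$ for all $\alpha\in\mathrm{Dom}(h)$. In both cases $H$ is $(<\kappa)$-free if each $H'\subseteq H$ with $|H'|<\kappa$ is free. * $\kappa\in SP_{\aleph_0}$ (resp. $\kappa\in SQ_{\aleph_0}$) iff there is a $(<\kappa)$-free non-free family $H$ with $|H|=\kappa$ of functions from countably infinite sets of ordinals to $\omega$ (resp. to $\mathrm{Pic}$). * $SPd_{\aleph_0}$ is defined as $SP_{\aleph_0}$ with each $h\in H$ one-to-one. $SQd_{\aleph_0}$ is defined as $SQ_{\aleph_0}$ with each $h\in H$ simple: there are an enumeration $\mathrm{Dom}(h)=\{\alpha_k:k<\omega\}$ without repetitions and $\beta_k,\gamma_k<\omega$ with $\gamma$ strictly increasing, $\beta_j<\gamma_k$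 for $j<k$, and $Cl(h(\alpha_k))=\{p:p\not\le(\beta_k,\gamma_k)\}$. * $\kappa\in SPw_{\aleph_0}$ (resp. $\kappa\in SQw_{\aleph_0}$) iff there is a set $H$ with $|H|=\kappa$ of pairs $(h,\bar u)$, where $h$ is a function from a set of ordinals to $\omega$ (resp. to $\mathrm{Pic}$) and $\bar u=\langle u_n:n<\omega\rangle$ is a decreasing sequence of subsets of $\mathrm{Dom}(h)$ (resp. with moreover $\bigcap_n u_n=\emptyset$), such that $(H',Z')$ is free for all $H'\subseteq H$ and all sets $Z'$ of ordinals with $|H'|,|Z'|<\kappa$, but $(H,\mathrm{Ord})$ is not free. Here $(H',Z')$ is free if there are $g:H'\to\omega$ and $f:\mathrm{Ord}\to\omega$ such that for all $(h,\bar u)\in H'$ and $\alpha\in Z'\cap\mathrm{Dom}(h)$ we have $h(\alpha)\le\max\{f(\alpha),g(h,\bar u)\}$ (resp. $(g(h,\bar u),f(\alpha))\in Cl(h(\alpha))$). A system $\langle\langle u_{\alpha,n}:n<\omega\rangle:\alpha\in v\rangle$ of decreasing sequences of subsets of a set $v$ has a free restriction to $v'\subseteq v$ if there is $f:v'\to\omega$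 such that the sets $u_{\alpha,f(\alpha)}$ $(\alpha\in v')$ are pairwise disjoint; it is free if this holds for $v'=v$. Theorem. Assume $\aleph_0\le\lambda<\mu$ and $\kappa^{\aleph_0}<\mu$ for all $\kappa<\mu$ (possibly $\mu=\infty$). The following are equivalent. * (A) There is a first countable Hausdorff space with $<\mu$ points that is $(<\lambda)$-metrizable and not metrizable. * (B) There is a first countable Hausdorff space with $<\mu$ points that is $(<\lambda)$-CWH but, for some $\lambda'\in[\lambda,\mu)$, not $\lambda'$-CWH. * (B)$^+$ As (B), with the space in addition $(<\lambda)$-metrizable. * (C) There is a first countable Hausdorff space with $<\mu$ points that is $(<\lambda)$-$^*$CWN but, for some $\lambda'\in[\lambda,\mu)$, not $\lambda'$-$^*$CWN. * (C)$^+$ As (C), with the space in addition $(<\lambda)$-metrizable. * (D) There is a $(<\lambda)$-free non-free family $H$, $|H|<\mu$, of functions from countable sets of ordinals to $\omega$. * (D)$^+$ As (D), with in addition $\bigcup\{\mathrm{Dom}(h):h\in H\}=\lambda'$ (the set of ordinals below $\lambda'$) for some cardinal $\lambda'\in[\lambda,\mu)$, and each $h\in H$ one-to-one. * (D)$'$,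 (D)$''$, (D)$'''$: $[\lambda,\mu)$ meets $SP_{\aleph_0}$; $[\lambda,\mu)$ meets $SPw_{\aleph_0}$; $[\lambda,\mu)$ meets $SPd_{\aleph_0}$. * (E) There are a set $v$ with $|v|<\mu$ and sets $u_{\alpha,n+1}\subseteq u_{\alpha,n}\subseteq v$ $(\alpha\in v,\ n<\omega)$ such that the system is not free, but its restriction to every $v'\subseteq v$ with $|v'|<\lambda$ is free. * (E)$'$, (E)$''$, (E)$'''$: $[\lambda,\mu)$ meets $SQ_{\aleph_0}$; $[\lambda,\mu)$ meets $SQw_{\aleph_0}$; $[\lambda,\mu)$ meets $SQd_{\aleph_0}$. -/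

import Mathlib

open Cardinal

universe u

namespace Freeness

/-! ### Topological notions -/

section Topology

variable (X : Type u) [TopologicalSpace X]

/-- Every subspace with fewer than `lam` points is metrizable. -/
def LtMetrizable (lam : Cardinal.{u}) : Prop :=
  ∀ Y : Set X, #Y < lam → TopologicalSpace.MetrizableSpace Y

/-- Collectionwise Hausdorff: the points of every subset `Y` whose subspace topology is discrete
have pairwise disjoint open neighbourhoods in `X` (`Y` is not assumed to be closed). -/
def IsCWH : Prop :=
  ∀ Y : Set X, DiscreteTopology Y →
    ∃ U : Y → Set X, (∀ y, IsOpen (U y) ∧ (y : X) ∈ U y) ∧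
      ∀ y z, y ≠ z → Disjoint (U y) (U z)

/-- `(< lam)`-CWH: every subspace with fewer than `lam` points is CWH. -/
def LtCWH (lam : Cardinal.{u}) : Prop :=
  ∀ Y : Set X, #Y < lam → IsCWH Y

/-- `lam`-CWH, that is, `(< lam⁺)`-CWH. -/
def LeCWH (lam : Cardinal.{u}) : Prop :=
  LtCWH X (Order.succ lam)

/-- Collectionwise normal: pairwise disjoint sets, each of which is clopen in the subspace
formed by their union, have pairwise disjoint open neighbourhoods in `X`. -/
def IsCWN : Prop :=
  ∀ (ι : Type u) (Y : ι → Set X),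
    (∀ i j, i ≠ j → Disjoint (Y i) (Y j)) →
    (∀ i, IsClopen {x : (⋃ j, Y j : Set X) | (x : X) ∈ Y i}) →
    ∃ U : ι → Set X, (∀ i, IsOpen (U i) ∧ Y i ⊆ U i) ∧
      ∀ i j, i ≠ j → Disjoint (U i) (U j)

/-- `(< lam)`-*CWN: every subspace with fewer than `lam` points is CWN. -/
def LtStarCWN (lam : Cardinal.{u}) : Prop :=
  ∀ Y : Set X, #Y < lam → IsCWN Y

/-- `lam`-*CWN, that is, `(< lam⁺)`-*CWN. -/
def LeStarCWN (lam : Cardinal.{u}) : Prop :=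
  LtStarCWN X (Order.succ lam)

end Topology

/-- The set of cardinals in `[lam, μ)`, where `μ` is a cardinal or `∞`. -/
def interval (lam : Cardinal.{u}) (μ : WithTop Cardinal.{u}) : Set Cardinal.{u} :=
  {κ | lam ≤ κ ∧ (κ : WithTop Cardinal.{u}) < μ}

/-- A set in the next universe (such as a set of functions on ordinals) has `κ` elements. -/
def HasCard {T : Type (u + 1)} (H : Set T) (κ : Cardinal.{u}) : Prop :=
  #H = Cardinal.lift.{u + 1} κ

/-- A set in the next universe has fewer than `κ` elements. -/
def CardLt {T : Type (u + 1)} (H : Set T) (κ : Cardinal.{u}) : Prop :=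
  #H < Cardinal.lift.{u + 1} κ

/-! ### Families of partial functions from the ordinals to `ω`

Everything is for `θ = ℵ₀` and `σ = 1`; for `σ = 1`, "`σ`-free" means "free". -/

/-- A family `H` of partial functions from the ordinals to `ω` is free. -/
def IsFree (H : Set (Ordinal.{u} →. ℕ)) : Prop :=
  ∃ g : Ordinal.{u} → ℕ, ∀ h ∈ H, ∃ ξ : ℕ, ∀ α, ∀ n ∈ h α, n ≤ g α ∨ n ≤ ξ

/-- Every subfamily with fewer than `lam` members is free. -/
def LtFree (H : Set (Ordinal.{u} →. ℕ)) (lam : Cardinal.{u}) : Prop :=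
  ∀ H' ⊆ H, CardLt H' lam → IsFree H'

/-- A one-to-one partial function. -/
def OneToOne (h : Ordinal.{u} →. ℕ) : Prop :=
  ∀ α β n, n ∈ h α → n ∈ h β → α = β

/-- `H` witnesses `lam ∈ SP`. -/
def WitnessSP (H : Set (Ordinal.{u} →. ℕ)) (lam : Cardinal.{u}) : Prop :=
  (∀ h ∈ H, #h.Dom = ℵ₀) ∧ LtFree H lam ∧ ¬ IsFree H ∧ HasCard H lam

/-- The spectrum `SP` for `θ = ℵ₀`. -/
def SP : Set Cardinal.{u} :=
  {lam | ∃ H, WitnessSP H lam}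

/-- The spectrum `SPd` for `θ = ℵ₀`. -/
def SPd : Set Cardinal.{u} :=
  {lam | ∃ H, WitnessSP H lam ∧ ∀ h ∈ H, OneToOne h}

/-- A pair `(H, Z)` is free, where `H` consists of pairs `(h, ū)` and `Z` is a class of ordinals. -/
def PairFree (H : Set ((Ordinal.{u} →. ℕ) × (ℕ → Set Ordinal.{u}))) (Z : Set Ordinal.{u}) : Prop :=
  ∃ (g : H → ℕ) (f : Ordinal.{u} → ℕ),
    ∀ p : H, ∀ α ∈ Z, ∀ n ∈ p.1.1 α, n ≤ max (f α) (g p)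

/-- The spectrum `SPw` for `θ = ℵ₀`. `Small` says that the domain of `h` is a set of ordinals,
not a proper class. -/
def SPw : Set Cardinal.{u} :=
  {lam | ∃ H : Set ((Ordinal.{u} →. ℕ) × (ℕ → Set Ordinal.{u})),
    (∀ p ∈ H, Small.{u} p.1.Dom ∧ Antitone p.2 ∧ ∀ ε, p.2 ε ⊆ p.1.Dom) ∧
    (∀ H' ⊆ H, ∀ Z' : Set Ordinal.{u}, CardLt H' lam → CardLt Z' lam → PairFree H' Z') ∧
    ¬ PairFree H Set.univ ∧ HasCard H lam}

/-! ### Families of partial functions from the ordinals to antichains of `ω × ω` -/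

/-- The antichains of `ω × ω` in the coordinatewise order. -/
def Pic : Set (Set (ℕ × ℕ)) :=
  {a | ∀ p ∈ a, ∀ q ∈ a, p ≠ q → ¬ p ≤ q}

/-- The upward closure of `a` in the coordinatewise order. -/
def Cl (a : Set (ℕ × ℕ)) : Set (ℕ × ℕ) :=
  {q | ∃ p ∈ a, p ≤ q}

/-- A family `H` of partial functions from the ordinals to subsets of `ω × ω` is free. -/
def IsFreeQ (H : Set (Ordinal.{u} →. Set (ℕ × ℕ))) : Prop :=
  ∃ g : Ordinal.{u} → ℕ, ∀ h ∈ H, ∃ ξ : ℕ, ∀ α, ∀ a ∈ h α, (g α, ξ) ∈ Cl a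

/-- Every subfamily with fewer than `lam` members is free. -/
def LtFreeQ (H : Set (Ordinal.{u} →. Set (ℕ × ℕ))) (lam : Cardinal.{u}) : Prop :=
  ∀ H' ⊆ H, CardLt H' lam → IsFreeQ H'

/-- `H` witnesses `lam ∈ SQ`. -/
def WitnessSQ (H : Set (Ordinal.{u} →. Set (ℕ × ℕ))) (lam : Cardinal.{u}) : Prop :=
  (∀ h ∈ H, #h.Dom = ℵ₀ ∧ ∀ α, ∀ a ∈ h α, a ∈ Pic) ∧
    LtFreeQ H lam ∧ ¬ IsFreeQ H ∧ HasCard H lam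

/-- The spectrum `SQ` for `θ = ℵ₀`. -/
def SQ : Set Cardinal.{u} :=
  {lam | ∃ H, WitnessSQ H lam}

/-- `h` is simple: its domain has an enumeration `α 0, α 1, …` without repetitions such that
`h (α k)` generates `{p | ¬ p ≤ (β k, γ k)}`, where `γ` is strictly increasing and `γ k` exceeds
all `β j` with `j < k`. -/
def Simple (h : Ordinal.{u} →. Set (ℕ × ℕ)) : Prop :=
  ∃ (α : ℕ → Ordinal.{u}) (β γ : ℕ → ℕ),
    Function.Injective α ∧ Set.range α = h.Dom ∧
    StrictMono γ ∧ (∀ j k, j < k → β j < γ k) ∧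
    ∀ k, ∀ a ∈ h (α k), Cl a = {p : ℕ × ℕ | ¬ p ≤ (β k, γ k)}

/-- The spectrum `SQd` for `θ = ℵ₀`. -/
def SQd : Set Cardinal.{u} :=
  {lam | ∃ H, WitnessSQ H lam ∧ ∀ h ∈ H, Simple h}

/-- A pair `(H, Z)` is free, where `H` consists of pairs `(h, ū)` and `Z` is a class of ordinals. -/
def PairFreeQ (H : Set ((Ordinal.{u} →. Set (ℕ × ℕ)) × (ℕ → Set Ordinal.{u})))
    (Z : Set Ordinal.{u}) : Prop :=
  ∃ (g : H → ℕ) (f : Ordinal.{u} → ℕ),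
    ∀ p : H, ∀ α ∈ Z, ∀ a ∈ p.1.1 α, (g p, f α) ∈ Cl a

/-- The spectrum `SQw` for `θ = ℵ₀`. -/
def SQw : Set Cardinal.{u} :=
  {lam | ∃ H : Set ((Ordinal.{u} →. Set (ℕ × ℕ)) × (ℕ → Set Ordinal.{u})),
    (∀ p ∈ H, Small.{u} p.1.Dom ∧ (∀ α, ∀ a ∈ p.1 α, a ∈ Pic) ∧
      Antitone p.2 ∧ (∀ ε, p.2 ε ⊆ p.1.Dom) ∧ ⋂ ε, p.2 ε = ∅) ∧
    (∀ H' ⊆ H, ∀ Z' : Set Ordinal.{u}, CardLt H' lam → CardLt Z' lam → PairFreeQ H' Z') ∧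
    ¬ PairFreeQ H Set.univ ∧ HasCard H lam}

/-! ### Systems of decreasing sequences of sets -/

/-- The restriction to `v'` of the system `⟨⟨u α n : n < ω⟩ : α ∈ V⟩` is free: one can choose
`f α` for `α ∈ v'` so that the sets `u α (f α)` are pairwise disjoint. -/
def SystemFreeOn {V : Type u} (U : V → ℕ → Set V) (v' : Set V) : Prop :=
  ∃ f : V → ℕ, ∀ α ∈ v', ∀ β ∈ v', α ≠ β → Disjoint (U α (f α)) (U β (f β))

end Freeness

/-! Every statement is equivalent to `Incompact lam μ`: some family of fewer than `μ` functions with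
countable domains is not dominated by one function modulo constants, although each subfamily with
fewer than `lam` members is.

The common form of the conditions is a choice problem: upper sets `A p z` of pairs of natural
numbers are given, and one seeks `g`, `f` with `(g p, f z) ∈ A p z` for all `p`, `z`. Freeness of
pairs, disjoint shrinking of set systems, separation by basic neighbourhoods in a first countable
space, and the two steps of a metrization argument all have this form. The heart of the proof is
`incompact_of_choice`: an incompact choice problem yields an incompact family of functions. It
replaces `p` by pairs `(p, b)` and `z` by pairs `(z, τ)`, where `b` and `τ` are monotone functions
on `ω`, and codes `A p z` by the single number `height`. A solution bounds the heights by `max (b (g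
p)) (τ (f z))`; conversely a bound `G (p, b)` modulo constants yields a solution by diagonalizing
over `b` and `τ`. Domination of a function modulo a constant can be tested on countable sets of
arguments, so countable domains suffice; closure of `μ` under countable powers keeps the family
small.

For topological problems with uncountable `lam`, a failure of disjointness or inclusion is witnessed
by a point; adding such points for countably many parameters and all pairs from a small set gives a
small subspace, in which the hypothesis supplies a solution. For metrizability, a development and
iterated refinements of neighbourhood assignments produce a countable base of a uniformity.

In the other direction the functions `h i` define a space: `(i, a)` is an isolated point attached to
`i` and to `a`, at level `h i a`. Disjoint shrinking of the attached sets is exactly domination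
(`Dominated.exists_shrink`, `dominated_of_disjoint`). Restricting to sets where the functions are
injective, and then taking a non-free subfamily of least size, gives the spectra. -/

namespace Freeness

/-! ### Cardinal arithmetic below `μ` -/

section Arithmetic

variable {μ : WithTop Cardinal.{u}}

/-- `μ` is uncountable and closed under `κ ↦ κ ^ ℵ₀`. -/
def PowClosed (μ : WithTop Cardinal.{u}) : Prop :=
  ((ℵ₀ : Cardinal.{u}) : WithTop Cardinal.{u}) < μ ∧
    ∀ κ : Cardinal.{u}, (κ : WithTop Cardinal.{u}) < μ →
      ((κ ^ (ℵ₀ : Cardinal.{u}) : Cardinal.{u}) : WithTop Cardinal.{u}) < μ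

theorem coe_lt_of_le {a b : Cardinal.{u}} (hab : a ≤ b) (hb : (b : WithTop Cardinal.{u}) < μ) :
    (a : WithTop Cardinal.{u}) < μ :=
  (WithTop.coe_le_coe.2 hab).trans_lt hb

theorem coe_max_lt {a b : Cardinal.{u}} (ha : (a : WithTop Cardinal.{u}) < μ)
    (hb : (b : WithTop Cardinal.{u}) < μ) :
    ((max a b : Cardinal.{u}) : WithTop Cardinal.{u}) < μ := by
  rcases max_choice a b with h | h <;> rwa [h]

theorem PowClosed.mul_lt (hμ : PowClosed μ) {a b : Cardinal.{u}}
    (ha : (a : WithTop Cardinal.{u}) < μ) (hb : (b : WithTop Cardinal.{u}) < μ) :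
    ((a * b : Cardinal.{u}) : WithTop Cardinal.{u}) < μ := by
  refine coe_lt_of_le ?_ (coe_max_lt (coe_max_lt ha hb) hμ.1)
  exact mul_le_max a b

theorem PowClosed.add_lt (hμ : PowClosed μ) {a b : Cardinal.{u}}
    (ha : (a : WithTop Cardinal.{u}) < μ) (hb : (b : WithTop Cardinal.{u}) < μ) :
    ((a + b : Cardinal.{u}) : WithTop Cardinal.{u}) < μ :=
  coe_lt_of_le (add_le_max a b) (coe_max_lt (coe_max_lt ha hb) hμ.1)

theorem PowClosed.mk_fun_lt (hμ : PowClosed μ) {α : Type u}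
    (ha : (#α : WithTop Cardinal.{u}) < μ) : (#(ℕ → α) : WithTop Cardinal.{u}) < μ := by
  simpa using hμ.2 _ ha

theorem PowClosed.mk_nat_fun_lt (hμ : PowClosed μ) :
    (#(ULift.{u} (ℕ → ℕ)) : WithTop Cardinal.{u}) < μ := by
  have := hμ.2 _ hμ.1
  simpa using this

end Arithmetic

/-! ### Incompact families of functions on a set -/

/-- The functions `h i` with `i ∈ I'`, restricted to `D i`, are dominated modulo constants by a
single function. -/
def Dominated {I S : Type u} (D : I → Set S) (h : I → S → ℕ) (I' : Set I) : Prop :=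
  ∃ G : S → ℕ, ∀ i ∈ I', ∃ ξ : ℕ, ∀ a ∈ D i, h i a ≤ max (G a) ξ

/-- There is a family of fewer than `μ` functions with countable domains which is not dominated,
while every subfamily with fewer than `lam` members is. -/
def Incompact (lam : Cardinal.{u}) (μ : WithTop Cardinal.{u}) : Prop :=
  ∃ (I S : Type u) (D : I → Set S) (h : I → S → ℕ), (∀ i, (D i).Countable) ∧
    (#I : WithTop Cardinal.{u}) < μ ∧ (#S : WithTop Cardinal.{u}) < μ ∧
    (∀ I' : Set I, #I' < lam → Dominated D h I') ∧ ¬ Dominated D h Set.univ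

theorem dominated_of_finite {I S : Type u} (D : I → Set S) (h : I → S → ℕ) {I' : Set I}
    (hI : I'.Finite) : Dominated D h I' :=
  ⟨fun a => ∑ i ∈ hI.toFinset, h i a, fun _ hi => ⟨0, fun a _ => le_max_of_le_left
    (Finset.single_le_sum (f := fun i => h i a) (fun _ _ => Nat.zero_le _) (hI.mem_toFinset.2 hi))⟩⟩

/-- Diagonalization: `G a + a + 1` exceeds `max (G a) ξ` at `a = ξ`. So the case `lam = ℵ₀` is
settled outright, and witness sets are needed only for uncountable `lam`. -/
theorem incompact_aleph0 {μ : WithTop Cardinal.{u}} (hμ : PowClosed μ) :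
    Incompact.{u} ℵ₀ μ := by
  refine ⟨ULift (ℕ → ℕ), ULift ℕ, fun _ => Set.univ, fun i a => i.down a.down,
    fun _ => Set.countable_univ, hμ.mk_nat_fun_lt, by simpa using hμ.1, fun I' hI =>
    dominated_of_finite _ _ (lt_aleph0_iff_set_finite.1 hI), ?_⟩
  rintro ⟨G, hG⟩
  obtain ⟨ξ, hξ⟩ := hG ⟨fun a => G ⟨a⟩ + a + 1⟩ trivial
  have := hξ ⟨ξ⟩ trivial
  simp only [le_max_iff] at this
  lia

/-! ### Choice problems given by upper sets of pairs of natural numbers -/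

section ChoiceProblem

variable {P : Type u} {Z : Type*} (A : P → Z → Set (ℕ × ℕ))

/-- The number which one of the values at `(p, b)` and `(z, τ)` has to reach. -/
noncomputable def height (z : Z) (τ : ℕ →o ℕ) (r : P × (ℕ →o ℕ)) : ℕ :=
  sSup {N | ∃ β γ, (β, γ) ∉ A r.1 z ∧ N = min (r.2 (β + 1)) (τ (γ + 1))}

variable {A}

/-- A pair `(β, γ)` outside an upper set containing `(x, y)` has `β < x` or `γ < y`, so its minimum
is at most `b x` or `τ y`. In particular the supremum in `height` is genuine, not the default value
`0`. -/
theorem mem_upperBounds_height {x y : ℕ} {p : P} {z : Z} (hA : IsUpperSet (A p z))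
    (h : (x, y) ∈ A p z) (τ b : ℕ →o ℕ) :
    max (b x) (τ y) ∈
      upperBounds {N | ∃ β γ, (β, γ) ∉ A p z ∧ N = min (b (β + 1)) (τ (γ + 1))} := by
  rintro N ⟨β, γ, hβ, rfl⟩
  by_contra! hlt
  rw [max_lt_iff, lt_min_iff, lt_min_iff] at hlt
  refine hβ (hA (Prod.mk_le_mk.2 ⟨?_, ?_⟩) h)
  · by_contra! hx
    exact (hlt.1.1.trans_le (b.mono hx)).false
  · by_contra! hy
    exact (hlt.2.2.trans_le (τ.mono hy)).false

theorem height_le {x y : ℕ} {p : P} {z : Z} (hA : IsUpperSet (A p z)) (h : (x, y) ∈ A p z)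
    (τ b : ℕ →o ℕ) : height A z τ (p, b) ≤ max (b x) (τ y) :=
  csSup_le' (mem_upperBounds_height hA h τ b)

theorem le_height {x y : ℕ} {p : P} {z : Z} (hA : IsUpperSet (A p z)) (h : (x, y) ∈ A p z)
    (τ b : ℕ →o ℕ) {β γ : ℕ} (hβ : (β, γ) ∉ A p z) :
    min (b (β + 1)) (τ (γ + 1)) ≤ height A z τ (p, b) :=
  le_csSup ⟨_, mem_upperBounds_height hA h τ b⟩ ⟨β, γ, hβ, rfl⟩

/-- The partial sums of a sequence, as a monotone function. -/
def partialSum (ρ : ℕ → ℕ) : ℕ →o ℕ :=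
  ⟨fun x => ∑ i ∈ Finset.range x, ρ i, fun _ _ h =>
    Finset.sum_le_sum_of_subset (Finset.range_mono h)⟩

theorem le_partialSum (ρ : ℕ → ℕ) (m : ℕ) : ρ m ≤ partialSum ρ (m + 1) :=
  Finset.single_le_sum (f := ρ) (fun _ _ => Nat.zero_le _) (Finset.self_mem_range_succ m)

/-- If every `m` failed, with bound `ρ m`, some `b` with `ρ m + m ≤ b (m + 1)` for all `m` would
have `b (m + 1) ≤ G b` for all `m`, which is absurd at `m = G b + 1`. -/
theorem exists_unbounded_below (G : (ℕ →o ℕ) → ℕ) :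
    ∃ m, ∀ N, ∃ b : ℕ →o ℕ, N ≤ b (m + 1) ∧ G b < b (m + 1) := by
  by_contra! h
  choose ρ hρ using h
  set b := partialSum fun m => ρ m + m with hb
  have h1 : ∀ m, ρ m + m ≤ b (m + 1) := le_partialSum _
  have h2 := hρ (G b + 1) b (by have := h1 (G b + 1); lia)
  have := h1 (G b + 1)
  lia

/-- If all values of `height` are dominated, the choice problem has a solution. -/
theorem exists_choice_of_height (hA : ∀ p z, IsUpperSet (A p z)) (hne : ∀ p z, (A p z).Nonempty)
    (G : P × (ℕ →o ℕ) → ℕ) (hG : ∀ z τ, ∃ F, ∀ r, height A z τ r ≤ max (G r) F) :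
    ∃ (g : P → ℕ) (f : Z → ℕ), ∀ p z, (g p, f z) ∈ A p z := by
  choose g hg using fun p => exists_unbounded_below fun b => G (p, b)
  suffices h : ∀ z, ∃ y, ∀ p, (g p, y) ∈ A p z by
    choose f hf using h
    exact ⟨g, f, fun p z => hf z p⟩
  intro z
  by_contra! h
  choose p hp using h
  choose b hb using fun k => hg (p k) k
  -- This `τ` satisfies `b k (g (p k) + 1) ≤ τ (k + 1)`, so the missing pair `(g (p k), k)` makes
  -- the height at `(p k, b k)` at least `b k (g (p k) + 1)`. That number exceeds `G`, and for `k =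
  -- F + 1` also `F`.
  obtain ⟨F, hF⟩ := hG z (partialSum fun k => b k (g (p k) + 1))
  obtain ⟨⟨x, y⟩, hxy⟩ := hne (p (F + 1)) z
  have h1 := le_height (hA _ _) hxy (partialSum fun k => b k (g (p k) + 1)) (b (F + 1)) (hp (F + 1))
  rw [min_eq_left (le_partialSum (fun k => b k (g (p k) + 1)) (F + 1))] at h1
  have h2 := h1.trans (hF _)
  have h3 := hb (F + 1)
  rw [le_max_iff] at h2
  lia

/-- A partial solution dominates the corresponding heights through `G (p, b) = b (g p)` and the
constants `τ (f z)`, while domination of all countable pieces would solve the whole problem. -/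
theorem incompact_of_choice {lam : Cardinal.{u}} {μ : WithTop Cardinal.{u}} (hμ : PowClosed μ)
    (hlam : ℵ₀ ≤ lam) {P : Type u} {Z : Type*} {A : P → Z → Set (ℕ × ℕ)}
    (hA : ∀ p z, IsUpperSet (A p z)) (hP : (#P : WithTop Cardinal.{u}) < μ)
    (hsmall : ∀ (P' : Set P) (Z' : Set Z), #P' < lam → lift.{u} #Z' < lift lam →
      ∃ (g : P → ℕ) (f : Z → ℕ), ∀ p ∈ P', ∀ z ∈ Z', (g p, f z) ∈ A p z)
    (hnot : ¬ ∃ (g : P → ℕ) (f : Z → ℕ), ∀ p z, (g p, f z) ∈ A p z) : Incompact lam μ := by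
  have hne : ∀ p z, (A p z).Nonempty := by
    intro p z
    have h1 : (1 : Cardinal.{u}) < lam := one_lt_aleph0.trans_le hlam
    obtain ⟨g, f, h⟩ := hsmall {p} {z} (by simpa using h1)
      (by simpa using h1)
    exact ⟨_, h p rfl z rfl⟩
  -- An index records only countably many arguments and the heights there; `z` and `τ` are merely
  -- required to exist. This bounds the number of indices independently of the size of `Z`, which
  -- may be a proper class.
  let I := {σ : ℕ → (P × (ℕ →o ℕ)) × ℕ //
    ∃ (z : Z) (τ : ℕ →o ℕ), ∀ k, (σ k).2 = height A z τ (σ k).1}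
  choose z τ hzτ using fun σ : I => σ.2
  have hord : (#(ULift.{u} (ℕ →o ℕ)) : WithTop Cardinal.{u}) < μ :=
    coe_lt_of_le (mk_le_of_injective (f := fun b : ULift.{u} (ℕ →o ℕ) =>
      (ULift.up (b.down : ℕ → ℕ) : ULift.{u} (ℕ → ℕ))) fun b c h => by
        exact ULift.ext _ _ (DFunLike.coe_injective (ULift.up_injective h))) hμ.mk_nat_fun_lt
  have hR : (#(P × (ℕ →o ℕ)) : WithTop Cardinal.{u}) < μ := by
    have := hμ.mul_lt hP hord
    simpa [mk_prod] using this
  refine ⟨I, P × (ℕ →o ℕ), fun σ => Set.range fun k => (σ.1 k).1, fun σ => height A (z σ) (τ σ),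
    fun _ => Set.countable_range _, ?_, hR, fun I' hI => ?_, ?_⟩
  · refine coe_lt_of_le (mk_subtype_le _) (hμ.mk_fun_lt ?_)
    have := hμ.mul_lt hR hμ.1
    simpa [mk_prod] using this
  -- A single index involves countably many `p`, too many for `hsmall` if `lam = ℵ₀`; but finite
  -- families are always dominated.
  · rcases hlam.eq_or_lt with rfl | hlam'
    · exact dominated_of_finite _ _ (lt_aleph0_iff_set_finite.1 hI)
    have h1 : #(Set.range fun x : I' × ℕ => (x.1.1.1 x.2).1.1) < lam := by
      refine mk_range_le.trans_lt ?_
      rw [mk_prod]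
      simpa using mul_lt_of_lt hlam hI hlam'
    have h2 : lift.{u} #(z '' I') < lift lam := mk_image_le_lift.trans_lt (lift_lt.2 hI)
    obtain ⟨g, f, hgf⟩ := hsmall _ _ h1 h2
    refine ⟨fun r => r.2 (g r.1), fun σ hσ => ⟨τ σ (f (z σ)), ?_⟩⟩
    rintro _ ⟨k, rfl⟩
    exact height_le (hA _ _) (hgf _ ⟨(⟨σ, hσ⟩, k), rfl⟩ _ ⟨σ, hσ, rfl⟩) _ _
  · rintro ⟨G, hG⟩
    refine hnot (exists_choice_of_height hA hne G fun z' τ' => ?_)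
    by_contra! h
    choose r hr using h
    -- The counterexamples `r k` to each constant `k` form one index; its constant `ξ` is refuted at
    -- `r ξ`.
    let σ : I := ⟨fun k => (r k, height A z' τ' (r k)), z', τ', fun _ => rfl⟩
    obtain ⟨ξ, hξ⟩ := hG σ trivial
    have h1 : height A (z σ) (τ σ) (r ξ) ≤ _ := hξ (r ξ) ⟨ξ, rfl⟩
    have h2 : height A z' τ' (r ξ) = height A (z σ) (τ σ) (r ξ) := hzτ σ ξ
    rw [← h2] at h1
    exact absurd h1 (not_le.2 (hr ξ))

end ChoiceProblem


/-! ### Families on the ordinals and the `SP` spectra -/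

section Spectra

variable {lam : Cardinal.{u}} {μ : WithTop Cardinal.{u}}

theorem lift_eq_self (c : Cardinal.{u + 1}) : lift.{u} c = c := lift_id'.{u, u + 1} c

theorem exists_hasCard_range {T : Type u} {X : Type (u + 1)} (f : T → X) :
    ∃ κ, HasCard (Set.range f) κ ∧ κ ≤ #T := by
  have h : #(Set.range f) ≤ lift.{u + 1} #T := by
    simpa [lift_eq_self] using mk_range_le_lift (f := f)
  obtain ⟨κ, hκ⟩ := mem_range_lift_of_le h
  exact ⟨κ, hκ.symm, by rwa [← hκ, lift_le] at h⟩

/-! ### From choice problems on classes to incompact families -/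

theorem incompact_of_choice_of_hasCard (hμ : PowClosed μ) (hlam : ℵ₀ ≤ lam) {T Z : Type (u + 1)}
    {H : Set T} {κ : Cardinal.{u}} (hH : HasCard H κ) (hκ : (κ : WithTop Cardinal.{u}) < μ)
    (A : T → Z → Set (ℕ × ℕ)) (hA : ∀ p z, IsUpperSet (A p z))
    (hsmall : ∀ H' ⊆ H, ∀ Z' : Set Z, CardLt H' lam → CardLt Z' lam →
      ∃ (g : H' → ℕ) (f : Z → ℕ), ∀ p : H', ∀ z ∈ Z', (g p, f z) ∈ A p z)
    (hnot : ¬ ∃ (g : H → ℕ) (f : Z → ℕ), ∀ (p : H) z, (g p, f z) ∈ A p z) :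
    Incompact lam μ := by
  classical
  have h1 : lift.{u + 1} #κ.out = lift.{u} #H := by
    rw [mk_out]
    have : #H = lift.{u + 1} κ := hH
    rw [this, lift_lift]
  obtain ⟨e⟩ := lift_mk_eq'.1 h1
  refine incompact_of_choice (P := κ.out) (A := fun p z => A (e p) z) hμ hlam (fun _ _ => hA _ _)
    (by rwa [mk_out]) (fun P' Z' hP hZ => ?_) ?_
  · have h2 : #((fun p => (e p : T)) '' P') < lift.{u + 1} lam := by
      have := (mk_image_le_lift (f := fun p => (e p : T)) (s := P')).trans_lt (lift_lt.2 hP)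
      simpa [lift_eq_self] using this
    obtain ⟨g, f, hgf⟩ := hsmall ((fun p => (e p : T)) '' P')
      (by rintro _ ⟨p, _, rfl⟩; exact (e p).2) Z' h2 (by simpa [CardLt, lift_eq_self] using hZ)
    exact ⟨fun p => if hp : p ∈ P' then g ⟨e p, p, hp, rfl⟩ else 0, f, fun p hp z hz => by
      simpa only [dif_pos hp] using hgf ⟨e p, p, hp, rfl⟩ z hz⟩
  · rintro ⟨g, f, hgf⟩
    exact hnot ⟨fun p => g (e.symm p), f, fun p z => by simpa using hgf (e.symm p) z⟩

theorem incompact_of_SPw (hμ : PowClosed μ) (hlam : ℵ₀ ≤ lam)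
    (h : (interval lam μ ∩ SPw).Nonempty) : Incompact lam μ := by
  obtain ⟨κ, ⟨hle, hκ⟩, H, -, hsmall, hnot, hH⟩ := h
  refine incompact_of_choice_of_hasCard hμ hlam hH hκ
    (fun p α => {q | ∀ n ∈ p.1 α, n ≤ max q.2 q.1}) (fun p z q q' hq h n hn =>
      (h n hn).trans (max_le_max hq.2 hq.1)) (fun H' hH' Z' h1 h2 => ?_) fun ⟨g, f, hgf⟩ =>
    hnot ⟨g, f, fun p α _ n hn => hgf p α n hn⟩
  exact hsmall H' hH' Z' (h1.trans_le (lift_le.2 hle)) (h2.trans_le (lift_le.2 hle))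

theorem incompact_of_SQw (hμ : PowClosed μ) (hlam : ℵ₀ ≤ lam)
    (h : (interval lam μ ∩ SQw).Nonempty) : Incompact lam μ := by
  obtain ⟨κ, ⟨hle, hκ⟩, H, -, hsmall, hnot, hH⟩ := h
  refine incompact_of_choice_of_hasCard hμ hlam hH hκ
    (fun p α => {q | ∀ a ∈ p.1 α, q ∈ Cl a}) (fun p z q q' hq h a ha => ?_)
    (fun H' hH' Z' h1 h2 => ?_) fun ⟨g, f, hgf⟩ => hnot ⟨g, f, fun p α _ n hn => hgf p α n hn⟩
  · obtain ⟨r, hr, hrq⟩ := h a ha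
    exact ⟨r, hr, hrq.trans hq⟩
  · exact hsmall H' hH' Z' (h1.trans_le (lift_le.2 hle)) (h2.trans_le (lift_le.2 hle))

theorem isFree_iff {H : Set (Ordinal.{u} →. ℕ)} : IsFree H ↔
    ∃ (g : H → ℕ) (f : Ordinal.{u} → ℕ), ∀ (p : H) α, ∀ n ∈ p.1 α, n ≤ max (f α) (g p) := by
  constructor
  · rintro ⟨f, hf⟩
    choose g hg using fun p : H => hf p p.2
    exact ⟨g, f, fun p α n hn => le_max_iff.2 (hg p α n hn)⟩
  · rintro ⟨g, f, hgf⟩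
    exact ⟨f, fun h hh => ⟨g ⟨h, hh⟩, fun α n hn => le_max_iff.1 (hgf ⟨h, hh⟩ α n hn)⟩⟩

theorem incompact_of_ltFree (hμ : PowClosed μ) (hlam : ℵ₀ ≤ lam) {H : Set (Ordinal.{u} →. ℕ)}
    (hfree : LtFree H lam) (hnot : ¬ IsFree H) {κ : Cardinal.{u}} (hH : HasCard H κ)
    (hκ : (κ : WithTop Cardinal.{u}) < μ) : Incompact lam μ := by
  refine incompact_of_choice_of_hasCard hμ hlam hH hκ
    (fun p α => {q | ∀ n ∈ p α, n ≤ max q.2 q.1}) (fun p z q q' hq h n hn =>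
      (h n hn).trans (max_le_max hq.2 hq.1)) (fun H' hH' Z' h1 h2 => ?_) fun h =>
    hnot (isFree_iff.2 h)
  obtain ⟨g, f, h⟩ := isFree_iff.1 (hfree H' hH' h1)
  exact ⟨g, f, fun p z _ => h p z⟩

/-! ### One-to-one incompact families -/

/-- Each function is replaced by all its restrictions to infinite sets on which it is injective;
there are at most `#I * #S ^ ℵ₀` of them. -/
theorem Incompact.exists_injOn (hμ : PowClosed μ) (h : Incompact lam μ) :
    ∃ (I S : Type u) (D : I → Set S) (h : I → S → ℕ),
      (∀ i, (D i).Countable ∧ (D i).Infinite ∧ Set.InjOn (h i) (D i)) ∧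
      (#I : WithTop Cardinal.{u}) < μ ∧ (#S : WithTop Cardinal.{u}) < μ ∧
      (∀ I' : Set I, #I' < lam → Dominated D h I') ∧ ¬ Dominated D h Set.univ := by
  obtain ⟨I, S, D, h, hD, hI, hS, hfree, hnot⟩ := h
  let J := {x : I × Set S // x.2 ⊆ D x.1 ∧ x.2.Infinite ∧ Set.InjOn (h x.1) x.2}
  have hJ : ∀ x : J, x.1.2.Countable := fun x => (hD _).mono x.2.1
  refine ⟨J, S, fun x => x.1.2, fun x => h x.1.1, fun x => ⟨hJ x, x.2.2⟩, ?_, hS, fun J' hJ' => ?_,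
    ?_⟩
  · choose e he using fun x : J => (hJ x).exists_eq_range x.2.2.1.nonempty
    refine coe_lt_of_le (mk_le_of_injective (f := fun x : J => (x.1.1, e x)) fun x y hxy => ?_)
      (b := #(I × (ℕ → S))) ?_
    · simp only [Prod.mk.injEq] at hxy
      exact Subtype.ext (Prod.ext hxy.1 (by rw [he x, he y, hxy.2]))
    · have := hμ.mul_lt hI (hμ.mk_fun_lt hS)
      simpa [mk_prod] using this
  · obtain ⟨G, hG⟩ := hfree ((fun x : J => x.1.1) '' J') (mk_image_le.trans_lt hJ')
    refine ⟨G, fun x hx => ?_⟩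
    obtain ⟨ξ, hξ⟩ := hG _ ⟨x, hx, rfl⟩
    exact ⟨ξ, fun a ha => hξ a (x.2.1 ha)⟩
  · rintro ⟨G, hG⟩
    refine hnot ⟨G, fun i _ => ?_⟩
    by_contra! hi
    -- A transversal of `h i` on the set where it exceeds `G` keeps all its values there, hence is
    -- unbounded, hence infinite: a restriction in the new family that `G` fails to dominate.
    obtain ⟨D', hD', hbij⟩ := Set.exists_subset_bijOn {a | a ∈ D i ∧ G a < h i a} (h i)
    have hunb : ∀ ξ, ∃ a ∈ D', ξ < h i a := by
      intro ξ
      obtain ⟨a, ha, hlt⟩ := hi ξ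
      rw [max_lt_iff] at hlt
      obtain ⟨b, hb, hab⟩ := hbij.surjOn ⟨a, ⟨ha, hlt.1⟩, rfl⟩
      exact ⟨b, hb, hab ▸ hlt.2⟩
    have hinf : D'.Infinite := by
      intro hfin
      obtain ⟨N, hN⟩ := (hfin.image (h i)).bddAbove
      obtain ⟨a, ha, hlt⟩ := hunb N
      exact (hN ⟨a, ha, rfl⟩).not_gt hlt
    obtain ⟨ξ, hξ⟩ := hG (⟨(i, D'), fun a ha => (hD' ha).1, hinf, hbij.injOn⟩ : J) trivial
    obtain ⟨a, ha, hlt⟩ := hunb ξ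
    have h1 := hξ a ha
    have h2 := (hD' ha).2
    simp only [le_max_iff] at h1
    lia

/-! ### Families on the ordinals -/

/-- The restriction of `h` to `D`, carried over to the ordinals by `e`. -/
noncomputable def toPFun {S : Type u} (e : S → Ordinal.{u}) (D : Set S) (h : S → ℕ) :
    Ordinal.{u} →. ℕ :=
  PFun.res (Function.extend e h 0) (e '' D)

theorem mem_toPFun {S : Type u} {e : S → Ordinal.{u}} (he : Function.Injective e) {D : Set S}
    {h : S → ℕ} {α : Ordinal.{u}} {n : ℕ} : n ∈ toPFun e D h α ↔ ∃ a ∈ D, e a = α ∧ h a = n := by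
  rw [toPFun, PFun.mem_res]
  constructor
  · rintro ⟨⟨a, ha, rfl⟩, rfl⟩
    exact ⟨a, ha, rfl, (he.extend_apply _ _ _).symm⟩
  · rintro ⟨a, ha, rfl, rfl⟩
    exact ⟨⟨a, ha, rfl⟩, he.extend_apply _ _ _⟩

theorem oneToOne_toPFun {S : Type u} {e : S → Ordinal.{u}} (he : Function.Injective e) {D : Set S}
    {h : S → ℕ} (hh : Set.InjOn h D) : OneToOne (toPFun e D h) := by
  intro α β n hα hβ
  obtain ⟨a, ha, rfl, h1⟩ := (mem_toPFun he).1 hα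
  obtain ⟨b, hb, rfl, h2⟩ := (mem_toPFun he).1 hβ
  rw [hh ha hb (h1.trans h2.symm)]

theorem isFree_image_toPFun {I S : Type u} {e : S → Ordinal.{u}} (he : Function.Injective e)
    {D : I → Set S} {h : I → S → ℕ} {I' : Set I} :
    IsFree ((fun i => toPFun e (D i) (h i)) '' I') ↔ Dominated D h I' := by
  constructor
  · rintro ⟨g, hg⟩
    refine ⟨g ∘ e, fun i hi => ?_⟩
    obtain ⟨ξ, hξ⟩ := hg _ ⟨i, hi, rfl⟩
    exact ⟨ξ, fun a ha => le_max_iff.2 (hξ (e a) _ ((mem_toPFun he).2 ⟨a, ha, rfl, rfl⟩))⟩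
  · rintro ⟨G, hG⟩
    refine ⟨Function.extend e G 0, ?_⟩
    rintro _ ⟨i, hi, rfl⟩
    obtain ⟨ξ, hξ⟩ := hG i hi
    refine ⟨ξ, fun α n hn => ?_⟩
    obtain ⟨a, ha, rfl, rfl⟩ := (mem_toPFun he).1 hn
    rw [he.extend_apply]
    exact le_max_iff.1 (hξ a ha)

/-- A subset of a range is the image of a set of indices of the same size. -/
theorem exists_image_eq_of_cardLt {I : Type u} {X : Type (u + 1)} {f : I → X} {H' : Set X}
    (hH : H' ⊆ Set.range f) (hlt : CardLt H' lam) : ∃ I' : Set I, #I' < lam ∧ f '' I' = H' := by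
  obtain ⟨I', hI', hbij⟩ := Set.exists_subset_bijOn (f ⁻¹' H') f
  rw [Set.image_preimage_eq_of_subset hH] at hbij
  refine ⟨I', ?_, hbij.image_eq⟩
  have h1 := mk_image_eq_of_injOn_lift f I' hbij.injOn
  rw [hbij.image_eq] at h1
  have h2 : lift.{u + 1} #I' < lift.{u + 1} lam := by
    rw [← h1, lift_eq_self]
    exact hlt
  exact lift_lt.1 h2

theorem ltFree_range_toPFun {I S : Type u} {e : S → Ordinal.{u}} (he : Function.Injective e)
    {D : I → Set S} {h : I → S → ℕ} (hfree : ∀ I' : Set I, #I' < lam → Dominated D h I') :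
    LtFree (Set.range fun i => toPFun e (D i) (h i)) lam := by
  intro H' hH' hlt
  obtain ⟨I', hI', rfl⟩ := exists_image_eq_of_cardLt hH' hlt
  exact (isFree_image_toPFun he).2 (hfree I' hI')

theorem not_isFree_range_toPFun {I S : Type u} {e : S → Ordinal.{u}} (he : Function.Injective e)
    {D : I → Set S} {h : I → S → ℕ} (hnot : ¬ Dominated D h Set.univ) :
    ¬ IsFree (Set.range fun i => toPFun e (D i) (h i)) := by
  rw [← Set.image_univ, isFree_image_toPFun he]
  exact hnot

/-- A non-free family contains a non-free subfamily of least possible size. -/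
theorem exists_minimal_not_isFree {H : Set (Ordinal.{u} →. ℕ)} (hfree : LtFree H lam)
    (hnot : ¬ IsFree H) {κ : Cardinal.{u}} (hH : HasCard H κ) :
    ∃ H₀ ⊆ H, ∃ κ₀ ≤ κ, lam ≤ κ₀ ∧ HasCard H₀ κ₀ ∧ LtFree H₀ κ₀ ∧ ¬ IsFree H₀ := by
  let s : Set Cardinal.{u} := {κ | ∃ H₀ ⊆ H, HasCard H₀ κ ∧ ¬ IsFree H₀}
  have hs : s.Nonempty := ⟨κ, H, subset_rfl, hH, hnot⟩
  obtain ⟨H₀, hH₀, hcard, hnot₀⟩ := csInf_mem hs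
  refine ⟨H₀, hH₀, sInf s, csInf_le' ⟨H, subset_rfl, hH, hnot⟩, ?_, hcard, ?_, hnot₀⟩
  · by_contra! hlt
    exact hnot₀ (hfree H₀ hH₀ (by rw [CardLt, hcard]; exact lift_lt.2 hlt))
  · intro H' hH' hlt
    by_contra hnot'
    obtain ⟨κ', hlt', hκ'⟩ := lt_lift_iff.1 hlt
    exact (csInf_le' (s := s) (⟨H', hH'.trans hH₀, hκ'.symm, hnot'⟩ : κ' ∈ s)).not_gt hlt'

/-- A spectrum asks for a family whose size equals its degree of freeness; a non-free subfamily of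
least size has this property and keeps injectivity and countable domains. -/
theorem Incompact.nonempty_SPd (hμ : PowClosed μ) (h : Incompact lam μ) :
    (interval lam μ ∩ SPd).Nonempty := by
  obtain ⟨I, S, D, h, hD, hI, hS, hfree, hnot⟩ := h.exists_injOn hμ
  obtain ⟨e⟩ : Nonempty (S ↪ Ordinal.{u}) := ⟨⟨_, Ordinal.typein_injective WellOrderingRel⟩⟩
  obtain ⟨κ, hκ, hκI⟩ := exists_hasCard_range fun i => toPFun e (D i) (h i)
  obtain ⟨H₀, hH₀, κ₀, hle, hlam, hcard, hfree₀, hnot₀⟩ := exists_minimal_not_isFree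
    (ltFree_range_toPFun e.injective hfree) (not_isFree_range_toPFun e.injective hnot) hκ
  refine ⟨κ₀, ⟨hlam, coe_lt_of_le (hle.trans hκI) hI⟩, H₀, ⟨fun p hp => ?_, hfree₀, hnot₀, hcard⟩,
    fun p hp => ?_⟩
  · obtain ⟨i, rfl⟩ := hH₀ hp
    have := ((hD i).1.image e).to_subtype
    have := ((hD i).2.1.image e.injective.injOn).to_subtype
    exact mk_eq_aleph0 (e '' D i)
  · obtain ⟨i, rfl⟩ := hH₀ hp
    exact oneToOne_toPFun e.injective (hD i).2.2

theorem SPd_subset_SP : SPd.{u} ⊆ SP := fun _ ⟨H, h, _⟩ => ⟨H, h⟩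

theorem SP_subset_SPw : SP.{u} ⊆ SPw := by
  rintro κ ⟨H, hdom, hfree, hnot, hcard⟩
  let j : (Ordinal.{u} →. ℕ) → (Ordinal.{u} →. ℕ) × (ℕ → Set Ordinal.{u}) := fun h => (h, fun _ => ∅)
  have hj : Function.Injective j := fun a b h => congrArg Prod.fst h
  refine ⟨j '' H, ?_, ?_, ?_, ?_⟩
  · rintro _ ⟨h, hh, rfl⟩
    refine ⟨?_, fun _ _ _ => subset_rfl, fun _ => Set.empty_subset _⟩
    have : Countable h.Dom := mk_le_aleph0_iff.1 (hdom h hh).le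
    exact Countable.toSmall _
  · intro H' hH' Z' h1 _
    obtain ⟨f, hf⟩ := hfree (Prod.fst '' H') (by
      rintro _ ⟨p, hp, rfl⟩
      obtain ⟨h, hh, rfl⟩ := hH' hp
      exact hh) (mk_image_le.trans_lt h1)
    choose g hg using fun p : H' => hf p.1.1 ⟨p, p.2, rfl⟩
    exact ⟨g, f, fun p α _ n hn => le_max_iff.2 (hg p α n hn)⟩
  · rintro ⟨g, f, hgf⟩
    exact hnot ⟨f, fun h hh => ⟨g ⟨j h, h, hh, rfl⟩, fun α n hn =>
      le_max_iff.1 (hgf ⟨j h, h, hh, rfl⟩ α trivial n hn)⟩⟩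
  · exact (mk_image_eq hj).trans hcard

end Spectra

/-! ### Domains filling a cardinal, and the `SQ` spectra -/

section Spectra

variable {lam : Cardinal.{u}} {μ : WithTop Cardinal.{u}}

/-- Zero functions on singletons are added to the family: they are one-to-one, impose no condition,
and make the domains cover the cardinal `max #S lam`. -/
theorem Incompact.exists_oneToOne_family (hμ : PowClosed μ)
    (hlam : (lam : WithTop Cardinal.{u}) < μ) (h : Incompact lam μ) :
    ∃ H : Set (Ordinal.{u} →. ℕ), (∀ h ∈ H, h.Dom.Countable) ∧ LtFree H lam ∧ ¬ IsFree H ∧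
      (∃ κ : Cardinal.{u}, HasCard H κ ∧ (κ : WithTop Cardinal.{u}) < μ) ∧
      (∃ lam' ∈ interval lam μ, ⋃ h ∈ H, h.Dom = Set.Iio lam'.ord) ∧
      (∀ h ∈ H, OneToOne h) := by
  obtain ⟨I, S, D, h, hD, hI, hS, hfree, hnot⟩ := h.exists_injOn hμ
  let κ := max #S lam
  have hκ : (κ : WithTop Cardinal.{u}) < μ := coe_max_lt hS hlam
  let T := κ.ord.ToType
  have hT : #T = κ := by simp [T]
  obtain ⟨e⟩ : Nonempty (S ↪ T) := by
    rw [← Cardinal.le_def, hT]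
    exact le_max_left _ _
  let c : T → Ordinal.{u} := fun t => (Ordinal.ToType.mk.symm t : Set.Iio κ.ord)
  have hc : Function.Injective c := Subtype.val_injective.comp Ordinal.ToType.mk.symm.injective
  let D' : I ⊕ T → Set T := Sum.elim (fun i => e '' D i) fun t => {t}
  let h' : I ⊕ T → T → ℕ := Sum.elim (fun i => Function.extend e (h i) 0) fun _ => 0
  have hext : ∀ i a, h' (Sum.inl i) (e a) = h i a := fun i a => e.injective.extend_apply _ _ _
  have hfree' : ∀ I' : Set (I ⊕ T), #I' < lam → Dominated D' h' I' := by
    intro I' hI'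
    obtain ⟨G, hG⟩ := hfree (Sum.inl ⁻¹' I')
      ((mk_preimage_of_injective _ _ Sum.inl_injective).trans_lt hI')
    refine ⟨Function.extend e G 0, ?_⟩
    rintro (i | t) hi
    · obtain ⟨ξ, hξ⟩ := hG i hi
      refine ⟨ξ, ?_⟩
      rintro _ ⟨a, ha, rfl⟩
      rw [hext, e.injective.extend_apply]
      exact hξ a ha
    · exact ⟨0, fun _ _ => Nat.zero_le _⟩
  have hnot' : ¬ Dominated D' h' Set.univ := by
    rintro ⟨G, hG⟩
    refine hnot ⟨G ∘ e, fun i _ => ?_⟩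
    obtain ⟨ξ, hξ⟩ := hG (Sum.inl i) trivial
    refine ⟨ξ, fun a ha => ?_⟩
    rw [← hext]
    exact hξ (e a) ⟨a, ha, rfl⟩
  obtain ⟨κ', hκ', hle⟩ := exists_hasCard_range fun i => toPFun c (D' i) (h' i)
  refine ⟨_, ?_, ltFree_range_toPFun hc hfree', not_isFree_range_toPFun hc hnot', ⟨κ', hκ', ?_⟩,
    ⟨κ, ⟨le_max_right _ _, hκ⟩, ?_⟩, ?_⟩
  · rintro _ ⟨i | t, rfl⟩
    · exact ((hD i).1.image e).image c
    · exact (Set.countable_singleton t).image c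
  · refine coe_lt_of_le hle ?_
    rw [mk_sum, lift_id, lift_id, hT]
    exact hμ.add_lt hI hκ
  · refine Set.Subset.antisymm (Set.iUnion₂_subset ?_) fun α hα => ?_
    · rintro _ ⟨i, rfl⟩ _ ⟨t, _, rfl⟩
      exact (Ordinal.ToType.mk.symm t).2
    · refine Set.mem_biUnion ⟨Sum.inr (Ordinal.ToType.mk ⟨α, hα⟩), rfl⟩ ?_
      exact ⟨_, rfl, by simp [c]⟩
  · rintro _ ⟨i | t, rfl⟩
    · refine oneToOne_toPFun hc ?_
      rintro _ ⟨a, ha, rfl⟩ _ ⟨b, hb, rfl⟩ hab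
      rw [hext, hext] at hab
      rw [(hD i).2.2 ha hb hab]
    · exact oneToOne_toPFun hc (Set.subsingleton_singleton.injOn _)

/-! ### Functions to antichains -/

theorem cardLt_of_image {X Y : Type (u + 1)} {j : X → Y} (hj : Function.Injective j) {H : Set X}
    {H' : Set Y} (hH : H' ⊆ j '' H) {κ : Cardinal.{u}} (h : CardLt H' κ) :
    ∃ H₀ ⊆ H, CardLt H₀ κ ∧ j '' H₀ = H' := by
  obtain ⟨H₀, h₀, rfl⟩ := Set.subset_image_iff.1 hH
  exact ⟨H₀, h₀, by rwa [CardLt, mk_image_eq hj] at h, rfl⟩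

theorem pfun_map_injective {α β γ : Type*} {f : β → γ} (hf : Function.Injective f) :
    Function.Injective (PFun.map f : (α →. β) → (α →. γ)) := by
  intro h h' heq
  have key : ∀ {h h' : α →. β}, PFun.map f h = PFun.map f h' → ∀ a, ∀ b ∈ h a, b ∈ h' a := by
    intro h h' heq a b hb
    have : f b ∈ PFun.map f h' a := heq ▸ Part.mem_map f hb
    obtain ⟨b', hb', hbb⟩ := (Part.mem_map_iff f).1 this
    rwa [← hf hbb]
  exact PFun.ext fun a b => ⟨key heq a b, key heq.symm a b⟩

/-- The antichain generating the complement of the square `{p | p ≤ (n, n)}`. -/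
def corner (n : ℕ) : Set (ℕ × ℕ) :=
  {(n + 1, 0), (0, n + 1)}

theorem corner_mem_Pic (n : ℕ) : corner n ∈ Pic := by
  rintro p (rfl | rfl) q (rfl | rfl) hpq
  · exact absurd rfl hpq
  · simp
  · simp
  · exact absurd rfl hpq

theorem mem_Cl_corner {n : ℕ} {q : ℕ × ℕ} : q ∈ Cl (corner n) ↔ n < q.1 ∨ n < q.2 := by
  simp [Cl, corner, Prod.le_def]

theorem corner_injective : Function.Injective corner := by
  intro m n h
  have h1 := @mem_Cl_corner m (n, 0)
  have h2 := @mem_Cl_corner n (m, 0)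
  have h3 := @mem_Cl_corner m (n + 1, 0)
  have h4 := @mem_Cl_corner n (m + 1, 0)
  rw [h] at h1 h3
  rw [← h] at h2 h4
  simp only [mem_Cl_corner] at h1 h2 h3 h4
  lia

theorem isFreeQ_map_corner {H : Set (Ordinal.{u} →. ℕ)} :
    IsFreeQ (PFun.map corner '' H) ↔ IsFree H := by
  constructor
  · rintro ⟨g, hg⟩
    refine ⟨g, fun h hh => ?_⟩
    obtain ⟨ξ, hξ⟩ := hg _ ⟨h, hh, rfl⟩
    refine ⟨ξ, fun α n hn => ?_⟩
    exact (mem_Cl_corner.1 (hξ α _ (Part.mem_map corner hn))).imp le_of_lt le_of_lt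
  · rintro ⟨g, hg⟩
    refine ⟨fun α => g α + 1, ?_⟩
    rintro _ ⟨h, hh, rfl⟩
    obtain ⟨ξ, hξ⟩ := hg h hh
    refine ⟨ξ + 1, fun α a ha => ?_⟩
    obtain ⟨n, hn, rfl⟩ := (Part.mem_map_iff corner).1 ha
    exact mem_Cl_corner.2 ((hξ α n hn).imp Nat.lt_succ_of_le Nat.lt_succ_of_le)

/-- The domain is listed by increasing values of `h`, and `β k = γ k` is the `k`-th value. -/
theorem simple_map_corner {h : Ordinal.{u} →. ℕ} (hdom : #h.Dom = ℵ₀) (hh : OneToOne h) :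
    Simple (PFun.map corner h) := by
  let V : Set ℕ := {n | ∃ α, n ∈ h α}
  have hV : V.Infinite := by
    have : Infinite h.Dom := infinite_iff.2 hdom.ge
    have hfn : ∀ a : h.Dom, h.fn a a.2 ∈ h a := fun a => Part.get_mem a.2
    have hinj : Function.Injective fun a : h.Dom => (⟨h.fn a a.2, a, hfn a⟩ : V) := by
      intro a b hab
      have hab' : h.fn a a.2 = h.fn b b.2 := congrArg Subtype.val hab
      exact Subtype.ext (hh a b _ (hfn a) (by rw [hab']; exact hfn b))
    exact Set.infinite_coe_iff.1 (Infinite.of_injective _ hinj)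
  have hmono : StrictMono (Nat.nth (· ∈ V)) := Nat.nth_strictMono hV
  have hmem : ∀ k, ∃ α, Nat.nth (· ∈ V) k ∈ h α := Nat.nth_mem_of_infinite hV
  choose α hα using hmem
  refine ⟨α, Nat.nth (· ∈ V), Nat.nth (· ∈ V), fun j k hjk => ?_, ?_, hmono,
    fun _ _ hjk => hmono hjk, fun k a ha => ?_⟩
  · exact hmono.injective (Part.mem_unique (hα j) (hjk ▸ hα k))
  · ext β
    constructor
    · rintro ⟨k, rfl⟩
      exact Part.dom_iff_mem.2 ⟨_, Part.mem_map corner (hα k)⟩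
    · intro hβ
      obtain ⟨a, ha⟩ := Part.dom_iff_mem.1 hβ
      obtain ⟨n, hn, -⟩ := (Part.mem_map_iff corner).1 ha
      have h1 : n ∈ Set.range (Nat.nth (· ∈ V)) :=
        (Nat.range_nth_of_infinite (p := (· ∈ V)) hV).symm.subset ⟨β, hn⟩
      obtain ⟨k, rfl⟩ := h1
      exact ⟨k, hh _ _ _ (hα k) hn⟩
  · obtain ⟨n, hn, rfl⟩ := (Part.mem_map_iff corner).1 ha
    rw [Part.mem_unique hn (hα k)]
    ext q
    simp only [mem_Cl_corner, Set.mem_ofPred_eq, Prod.le_def, not_and_or, not_le]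

theorem SPd_subset_SQd : SPd.{u} ⊆ SQd := by
  rintro κ ⟨H, ⟨hdom, hfree, hnot, hcard⟩, hone⟩
  have hj : Function.Injective (PFun.map corner : (Ordinal.{u} →. ℕ) → _) :=
    pfun_map_injective corner_injective
  refine ⟨PFun.map corner '' H, ⟨?_, ?_, ?_, ?_⟩, ?_⟩
  · rintro _ ⟨h, hh, rfl⟩
    refine ⟨hdom h hh, fun α a ha => ?_⟩
    obtain ⟨n, -, rfl⟩ := (Part.mem_map_iff corner).1 ha
    exact corner_mem_Pic n
  · intro H' hH' hlt
    obtain ⟨H₀, h₀, hlt₀, rfl⟩ := cardLt_of_image hj hH' hlt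
    exact isFreeQ_map_corner.2 (hfree H₀ h₀ hlt₀)
  · rwa [isFreeQ_map_corner]
  · exact (mk_image_eq hj).trans hcard
  · rintro _ ⟨h, hh, rfl⟩
    exact simple_map_corner (hdom h hh) (hone h hh)

theorem SQd_subset_SQ : SQd.{u} ⊆ SQ := fun _ ⟨H, h, _⟩ => ⟨H, h⟩

theorem mem_Cl_image_swap {a : Set (ℕ × ℕ)} {x y : ℕ} :
    (x, y) ∈ Cl (Prod.swap '' a) ↔ (y, x) ∈ Cl a := by
  constructor
  · rintro ⟨_, ⟨p, hp, rfl⟩, hle⟩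
    exact ⟨p, hp, hle.2, hle.1⟩
  · rintro ⟨p, hp, hle⟩
    exact ⟨_, ⟨p, hp, rfl⟩, hle.2, hle.1⟩

theorem SQ_subset_SQw : SQ.{u} ⊆ SQw := by
  rintro κ ⟨H, hdom, hfree, hnot, hcard⟩
  -- The ordinal governs the first coordinate in `IsFreeQ` but the second in `PairFreeQ`.
  let sw : Set (ℕ × ℕ) → Set (ℕ × ℕ) := fun a => Prod.swap '' a
  have hsw : Function.Injective sw := Set.image_injective.2 Prod.swap_injective
  let j : (Ordinal.{u} →. Set (ℕ × ℕ)) → (Ordinal.{u} →. Set (ℕ × ℕ)) × (ℕ → Set Ordinal.{u}) :=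
    fun h => (PFun.map sw h, fun _ => ∅)
  have hj : Function.Injective j := fun a b h => pfun_map_injective hsw (congrArg Prod.fst h)
  refine ⟨j '' H, ?_, ?_, ?_, (mk_image_eq hj).trans hcard⟩
  · rintro _ ⟨h, hh, rfl⟩
    refine ⟨?_, fun α a ha => ?_, fun _ _ _ => subset_rfl, fun _ => Set.empty_subset _,
      Set.iInter_const _⟩
    · have : Countable h.Dom := mk_le_aleph0_iff.1 (hdom h hh).1.le
      exact Countable.toSmall h.Dom
    · obtain ⟨b, hb, rfl⟩ := (Part.mem_map_iff sw).1 ha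
      rintro _ ⟨p, hp, rfl⟩ _ ⟨q, hq, rfl⟩ hne hle
      exact (hdom h hh).2 α b hb p hp q hq (fun h => hne (h ▸ rfl)) ⟨hle.2, hle.1⟩
  · intro H' hH' Z' h1 _
    obtain ⟨H₀, h₀, hlt₀, rfl⟩ := cardLt_of_image hj hH' h1
    obtain ⟨f, hf⟩ := hfree H₀ h₀ hlt₀
    have h2 : ∀ p : j '' H₀, ∃ ξ, ∀ α, ∀ a ∈ p.1.1 α, (ξ, f α) ∈ Cl a := by
      rintro ⟨_, h, hh, rfl⟩
      obtain ⟨ξ, hξ⟩ := hf h hh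
      refine ⟨ξ, fun α a ha => ?_⟩
      obtain ⟨b, hb, rfl⟩ := (Part.mem_map_iff sw).1 ha
      exact mem_Cl_image_swap.2 (hξ α b hb)
    choose g hg using h2
    exact ⟨g, f, fun p α _ a ha => hg p α a ha⟩
  · rintro ⟨g, f, hgf⟩
    exact hnot ⟨f, fun h hh => ⟨g ⟨j h, h, hh, rfl⟩, fun α a ha =>
      mem_Cl_image_swap.1 (hgf ⟨j h, h, hh, rfl⟩ α trivial _ (Part.mem_map sw ha))⟩⟩

end Spectra

/-! ### Metrizability and separation -/

section Metrizability

open Filter Topology TopologicalSpace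

/-- The relations form a countable base of a uniformity inducing the topology. -/
theorem pseudoMetrizableSpace_of_relations {X : Type*} [t : TopologicalSpace X]
    (E : ℕ → X → X → Prop) (hrefl : ∀ n x, E n x x) (hsymm : ∀ n x y, E n x y → E n y x)
    (hcomp : ∀ n x y z, E (n + 1) x y → E (n + 1) y z → E n x z)
    (hbasis : ∀ x, (𝓝 x).HasBasis (fun _ : ℕ => True) fun n => {y | E n x y}) :
    PseudoMetrizableSpace X := by
  have hanti : Antitone fun n => {p : X × X | E n p.1 p.2} :=
    antitone_nat_of_succ_le fun n p hp => hcomp n _ _ _ hp (hrefl _ _)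
  have hU : (⨅ n, 𝓟 {p : X × X | E n p.1 p.2}).HasBasis (fun _ : ℕ => True)
      fun n => {p | E n p.1 p.2} := hasBasis_iInf_principal hanti.directed_ge
  let U : UniformSpace X :=
    { toTopologicalSpace := t
      uniformity := ⨅ n, 𝓟 {p : X × X | E n p.1 p.2}
      symm := hU.tendsto_iff hU |>.2 fun n _ => ⟨n, trivial, fun p hp => hsymm _ _ _ hp⟩
      comp := by
        refine hU.ge_iff.2 fun n _ => ?_
        refine mem_of_superset (Filter.mem_lift' (hU.mem_of_mem (i := n + 1) trivial)) ?_
        rintro ⟨x, z⟩ ⟨y, h1, h2⟩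
        exact hcomp n x y z h1 h2
      nhds_eq_comap_uniformity := fun x => (hbasis x).eq_of_same_basis (hU.comap _) }
  have : (uniformity X).IsCountablyGenerated := hU.isCountablyGenerated
  exact inferInstance

theorem IsCWN.isCWH {X : Type u} [TopologicalSpace X] (h : IsCWN X) : IsCWH X := by
  intro Y hY
  obtain ⟨U, hU, hd⟩ := h Y (fun y => {(y : X)})
    (fun y z hyz => Set.disjoint_singleton.2 (Subtype.val_injective.ne hyz)) fun y => by
      have hmem : ∀ x : (⋃ y : Y, {(y : X)} : Set X), (x : X) ∈ Y := by
        rintro ⟨x, hx⟩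
        obtain ⟨z, rfl⟩ := Set.mem_iUnion.1 hx
        exact z.2
      have : DiscreteTopology (⋃ y : Y, {(y : X)} : Set X) :=
        DiscreteTopology.of_continuous_injective (f := fun x => (⟨x, hmem x⟩ : Y))
          (continuous_subtype_val.subtype_mk _) fun a b h => by
            simpa [Subtype.ext_iff] using h
      exact isClopen_discrete _
  exact ⟨U, fun y => ⟨(hU y).1, (hU y).2 rfl⟩, hd⟩

/-- Around each point take half of a radius that avoids the other sets. If two such balls for
different sets met, the larger full radius would reach the other centre. -/
theorem isCWN_of_metrizableSpace (X : Type u) [TopologicalSpace X] [MetrizableSpace X] :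
    IsCWN X := by
  let _ := metrizableSpaceMetric X
  intro ι Y hdisj hclopen
  have h : ∀ i, ∀ y ∈ Y i, ∃ r > 0, ∀ j, ∀ z ∈ Y j, dist z y < r → i = j := by
    intro i y hy
    obtain ⟨r, hr, hball⟩ := Metric.isOpen_iff.1 (hclopen i).isOpen
      ⟨y, Set.mem_iUnion.2 ⟨i, hy⟩⟩ hy
    refine ⟨r, hr, fun j z hz hlt => ?_⟩
    have : z ∈ Y i := hball (show (⟨z, Set.mem_iUnion.2 ⟨j, hz⟩⟩ : (⋃ j, Y j : Set X)) ∈ _ from hlt)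
    by_contra hij
    exact Set.disjoint_left.1 (hdisj i j hij) this hz
  choose! r hr hsep using h
  refine ⟨fun i => ⋃ y ∈ Y i, Metric.ball y (r i y / 2), fun i => ⟨?_, fun y hy => ?_⟩,
    fun i j hij => ?_⟩
  · exact isOpen_biUnion fun y _ => Metric.isOpen_ball
  · exact Set.mem_biUnion hy (Metric.mem_ball_self (half_pos (hr i y hy)))
  · rw [Set.disjoint_left]
    intro x hx hx'
    obtain ⟨y, hy, hxy⟩ := Set.mem_iUnion₂.1 hx
    obtain ⟨z, hz, hxz⟩ := Set.mem_iUnion₂.1 hx'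
    rw [Metric.mem_ball] at hxy hxz
    have h1 := dist_triangle_left y z x
    rcases le_total (r i y) (r j z) with h | h
    · exact hij (hsep j z hz i y hy (by linarith)).symm
    · exact hij (hsep i y hy j z hz (by rw [dist_comm]; linarith))

variable {X : Type u} [TopologicalSpace X] {lam : Cardinal.{u}}

theorem LtMetrizable.ltStarCWN (h : LtMetrizable X lam) : LtStarCWN X lam := fun Y hY =>
  have := h Y hY
  isCWN_of_metrizableSpace Y

theorem LtStarCWN.ltCWH (h : LtStarCWN X lam) : LtCWH X lam := fun Y hY => (h Y hY).isCWH

end Metrizability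

/-! ### A space in which two sequences of sets are attached to isolated points -/

section FanSpace

open Filter Topology TopologicalSpace

/-- The topology on `V ⊕ W` in which the points of `W` are isolated and `v` has the basic
neighbourhoods `{v} ∪ F v n`. -/
@[reducible] def fanTopology {V W : Type*} (F : V → ℕ → Set W) : TopologicalSpace (V ⊕ W) where
  IsOpen u := ∀ v, Sum.inl v ∈ u → ∀ᶠ n in atTop, F v n ⊆ Sum.inr ⁻¹' u
  isOpen_univ := fun _ _ => by simp
  isOpen_inter := fun s t hs ht v hv => by
    filter_upwards [hs v hv.1, ht v hv.2] with n h1 h2 using Set.subset_inter h1 h2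
  isOpen_sUnion := fun S hS v ⟨s, hs, hv⟩ => by
    filter_upwards [hS s hs v hv] with n h
    exact h.trans (Set.preimage_mono (Set.subset_sUnion_of_mem hs))

variable {V W : Type*} (F : V → ℕ → Set W)

/-- Basic neighbourhoods in `fanTopology F`. -/
def fanNhd : V ⊕ W → ℕ → Set (V ⊕ W)
  | Sum.inl v, n => insert (Sum.inl v) (Sum.inr '' F v n)
  | Sum.inr w, _ => {Sum.inr w}

variable {F}

theorem mem_fanNhd (x : V ⊕ W) (n : ℕ) : x ∈ fanNhd F x n := by
  cases x <;> simp [fanNhd]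

theorem inl_mem_fanNhd {v : V} {x : V ⊕ W} {n : ℕ} : Sum.inl v ∈ fanNhd F x n ↔ Sum.inl v = x := by
  cases x <;> simp [fanNhd]

theorem inr_mem_fanNhd_inl {v : V} {w : W} {n : ℕ} :
    Sum.inr w ∈ fanNhd F (Sum.inl v) n ↔ w ∈ F v n := by
  simp [fanNhd]

theorem antitone_fanNhd (hF : ∀ v, Antitone (F v)) (x : V ⊕ W) : Antitone (fanNhd F x) := by
  intro m n hmn
  cases x with
  | inl v => exact Set.insert_subset_insert (Set.image_mono (hF v hmn))
  | inr w => exact subset_rfl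

theorem isOpen_fanNhd (hF : ∀ v, Antitone (F v)) (x : V ⊕ W) (n : ℕ) :
    IsOpen[fanTopology F] (fanNhd F x n) := by
  intro v hv
  obtain rfl := inl_mem_fanNhd.1 hv
  filter_upwards [eventually_ge_atTop n] with m hm w hw
  exact inr_mem_fanNhd_inl.2 (hF v hm hw)

theorem hasAntitoneBasis_fanNhd (hF : ∀ v, Antitone (F v)) (x : V ⊕ W) :
    (@nhds _ (fanTopology F) x).HasAntitoneBasis (fanNhd F x) := by
  let _ := fanTopology F
  refine ⟨⟨fun s => ⟨fun hs => ?_, ?_⟩⟩, antitone_fanNhd hF x⟩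
  · obtain ⟨u, hus, hu, hx⟩ := mem_nhds_iff.1 hs
    cases x with
    | inl v =>
      obtain ⟨n, hn⟩ := (hu v hx).exists
      exact ⟨n, trivial, (Set.insert_subset hx (Set.image_subset_iff.2 hn)).trans hus⟩
    | inr w => exact ⟨0, trivial, Set.singleton_subset_iff.2 (hus hx)⟩
  · rintro ⟨n, -, hn⟩
    exact mem_of_superset ((isOpen_fanNhd hF x n).mem_nhds (mem_fanNhd x n)) hn

theorem firstCountableTopology_fan (hF : ∀ v, Antitone (F v)) :
    @FirstCountableTopology _ (fanTopology F) := by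
  let _ := fanTopology F
  exact ⟨fun x => (hasAntitoneBasis_fanNhd hF x).1.isCountablyGenerated⟩

theorem t2Space_fan (hF : ∀ v, Antitone (F v)) (hempty : ∀ v w, ∃ n, w ∉ F v n)
    (hsep : ∀ v v', v ≠ v' → ∃ n, Disjoint (F v n) (F v' n)) : @T2Space _ (fanTopology F) := by
  let _ := fanTopology F
  have key : ∀ x y : V ⊕ W, x ≠ y → ∃ n, Disjoint (fanNhd F x n) (fanNhd F y n) := by
    rintro (v | w) (v' | w') hne
    · have hvv : v ≠ v' := fun h => hne (h ▸ rfl)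
      obtain ⟨n, hn⟩ := hsep v v' hvv
      refine ⟨n, Set.disjoint_left.2 ?_⟩
      rintro (x | x) h1 h2
      · exact hne ((inl_mem_fanNhd.1 h1).symm.trans (inl_mem_fanNhd.1 h2))
      · exact Set.disjoint_left.1 hn (inr_mem_fanNhd_inl.1 h1) (inr_mem_fanNhd_inl.1 h2)
    · obtain ⟨n, hn⟩ := hempty v w'
      exact ⟨n, Set.disjoint_singleton_right.2 fun h => hn (inr_mem_fanNhd_inl.1 h)⟩
    · obtain ⟨n, hn⟩ := hempty v' w
      exact ⟨n, Set.disjoint_singleton_left.2 fun h => hn (inr_mem_fanNhd_inl.1 h)⟩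
    · exact ⟨0, Set.disjoint_singleton.2 hne⟩
  refine t2Space_iff_disjoint_nhds.2 fun x y hne => ?_
  obtain ⟨n, hn⟩ := key x y hne
  exact ((hasAntitoneBasis_fanNhd hF x).1.disjoint_iff (hasAntitoneBasis_fanNhd hF y).1).2
    ⟨n, trivial, n, trivial, hn⟩

/-- A subspace in which the sets attached to the points of `V` can be shrunk to disjoint ones is
metrizable. -/
theorem metrizableSpace_fan (hF : ∀ v, Antitone (F v)) (hempty : ∀ v w, ∃ n, w ∉ F v n)
    (hsep : ∀ v v', v ≠ v' → ∃ n, Disjoint (F v n) (F v' n)) (Y : Set (V ⊕ W)) (f : V → ℕ)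
    (hf : ∀ v v' w, v ≠ v' → Sum.inr w ∈ Y → w ∈ F v (f v) → w ∉ F v' (f v')) :
    @MetrizableSpace Y (@instTopologicalSpaceSubtype _ (· ∈ Y) (fanTopology F)) := by
  let _ := fanTopology F
  have := t2Space_fan hF hempty hsep
  let N : V → ℕ → Set (V ⊕ W) := fun v n => fanNhd F (Sum.inl v) (f v + n)
  have hN : ∀ v, Antitone (N v) := fun v m n h => antitone_fanNhd hF _ (by lia)
  have huniq : ∀ {v v' m n x}, x ∈ Y → x ∈ N v m → x ∈ N v' n → v = v' := by
    rintro v v' m n (x | w) hx h1 h2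
    · exact Sum.inl_injective ((inl_mem_fanNhd.1 h1).symm.trans (inl_mem_fanNhd.1 h2))
    · by_contra hne
      exact hf v v' w hne hx (hF v (Nat.le_add_right _ _) (inr_mem_fanNhd_inl.1 h1))
        (hF v' (Nat.le_add_right _ _) (inr_mem_fanNhd_inl.1 h2))
  have : PseudoMetrizableSpace Y := by
    -- Points are related at stage `n` if they are equal or share some `N v n`. Each point of `Y`
    -- belongs to such sets for at most one `v`, which gives the composition law.
    refine pseudoMetrizableSpace_of_relations
      (fun n x y => x = y ∨ ∃ v, (x : V ⊕ W) ∈ N v n ∧ (y : V ⊕ W) ∈ N v n)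
      (fun n x => Or.inl rfl) (fun n x y h => ?_) (fun n x y z h1 h2 => ?_) fun x => ⟨fun s => ?_⟩
    · rcases h with rfl | ⟨v, h1, h2⟩
      · exact Or.inl rfl
      · exact Or.inr ⟨v, h2, h1⟩
    · rcases h1 with rfl | ⟨v, h1, h1'⟩
      · rcases h2 with rfl | ⟨v, h2, h2'⟩
        · exact Or.inl rfl
        · exact Or.inr ⟨v, hN v n.le_succ h2, hN v n.le_succ h2'⟩
      · rcases h2 with rfl | ⟨v', h2, h2'⟩
        · exact Or.inr ⟨v, hN v n.le_succ h1, hN v n.le_succ h1'⟩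
        · obtain rfl := huniq y.2 h1' h2
          exact Or.inr ⟨v, hN v n.le_succ h1, hN v n.le_succ h2'⟩
    · have hb := ((hasAntitoneBasis_fanNhd hF x.1).1.comap (Subtype.val : Y → V ⊕ W))
      rw [nhds_subtype, hb.mem_iff]
      constructor
      · rintro ⟨n, -, hn⟩
        obtain ⟨x | w, hx⟩ := x
        · refine ⟨n, trivial, fun y hy => hn ?_⟩
          rcases hy with rfl | ⟨v, h1, h2⟩
          · exact mem_fanNhd (F := F) (Sum.inl x) n
          · obtain rfl := Sum.inl_injective (inl_mem_fanNhd.1 h1)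
            exact antitone_fanNhd hF _ (Nat.le_add_left _ _) h2
        · have hw : ∃ m, ∀ v, Sum.inr w ∉ N v m := by
            by_cases hv : ∃ v, Sum.inr w ∈ N v 0
            · obtain ⟨v, hv⟩ := hv
              obtain ⟨m, hm⟩ := hempty v w
              refine ⟨m, fun v' hv' => ?_⟩
              obtain rfl := huniq hx hv hv'
              exact hm (hF v (Nat.le_add_left _ _) (inr_mem_fanNhd_inl.1 hv'))
            · exact ⟨0, fun v h => hv ⟨v, h⟩⟩
          obtain ⟨m, hm⟩ := hw
          refine ⟨m, trivial, fun y hy => hn ?_⟩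
          rcases hy with rfl | ⟨v, h1, h2⟩
          · exact mem_fanNhd (F := F) (Sum.inr w) n
          · exact absurd h1 (hm v)
      · rintro ⟨n, -, hn⟩
        obtain ⟨x | w, hx⟩ := x
        · exact ⟨f x + n, trivial, fun y hy => hn (Or.inr ⟨x, mem_fanNhd _ _, hy⟩)⟩
        · exact ⟨0, trivial, fun y hy => hn (Or.inl (Subtype.ext (Set.mem_singleton_iff.1 hy).symm))⟩
  exact inferInstance

/-- If the subspace formed by the whole space is CWH, then the sets attached to the points of `V`
can be shrunk to disjoint ones. -/
theorem exists_disjoint_of_isCWH_fan {V W : Type u} {F : V → ℕ → Set W}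
    (hF : ∀ v, Antitone (F v))
    (h : @IsCWH (Set.univ : Set (V ⊕ W)) (@instTopologicalSpaceSubtype _ _ (fanTopology F))) :
    ∃ f : V → ℕ, ∀ v v', v ≠ v' → Disjoint (F v (f v)) (F v' (f v')) := by
  let _ := fanTopology F
  let i : V → (Set.univ : Set (V ⊕ W)) := fun v => ⟨Sum.inl v, trivial⟩
  have hi : Function.Injective i := fun v v' h => Sum.inl_injective (congrArg Subtype.val h)
  obtain ⟨U, hU, hd⟩ := h (Set.range i) (by
    refine discreteTopology_iff_isOpen_singleton.2 ?_
    rintro ⟨_, v, rfl⟩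
    have : IsOpen ((fun y : Set.range i => (y.1.1 : V ⊕ W)) ⁻¹' fanNhd F (Sum.inl v) 0) :=
      (isOpen_fanNhd hF _ 0).preimage (by fun_prop)
    convert this using 1
    ext ⟨_, v', rfl⟩
    constructor
    · intro h
      obtain rfl := hi (congrArg Subtype.val (Set.mem_singleton_iff.1 h))
      exact mem_fanNhd (F := F) (Sum.inl v') 0
    · intro h
      obtain rfl := Sum.inl_injective (inl_mem_fanNhd.1 h)
      rfl)
  have hf : ∀ v, ∃ n, F v n ⊆ {w | ⟨Sum.inr w, trivial⟩ ∈ U ⟨i v, v, rfl⟩} := by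
    intro v
    have h1 := (hU ⟨i v, v, rfl⟩).1.mem_nhds (hU ⟨i v, v, rfl⟩).2
    rw [nhds_subtype, ((hasAntitoneBasis_fanNhd hF _).1.comap _).mem_iff] at h1
    obtain ⟨n, -, hn⟩ := h1
    exact ⟨n, fun w hw => hn (inr_mem_fanNhd_inl.2 hw)⟩
  choose f hf using hf
  refine ⟨f, fun v v' hne => Set.disjoint_left.2 fun w h1 h2 => ?_⟩
  exact Set.disjoint_left.1 (hd ⟨i v, v, rfl⟩ ⟨i v', v', rfl⟩ fun h =>
    hne (hi (congrArg Subtype.val h))) (hf v h1) (hf v' h2)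

end FanSpace

/-! ### From incompact families to spaces and systems -/

section FromIncompact

open TopologicalSpace

variable {lam : Cardinal.{u}} {μ : WithTop Cardinal.{u}} {I S : Type u}

/-- The pairs `(i, a)` with `a ∈ D i` and `n ≤ h i a` are attached both to `a` and to `i`. -/
def fan (D : I → Set S) (h : I → S → ℕ) (v : S ⊕ I) (n : ℕ) : Set (I × S) :=
  {x | (v = Sum.inl x.2 ∨ v = Sum.inr x.1) ∧ x.2 ∈ D x.1 ∧ n ≤ h x.1 x.2}

variable {D : I → Set S} {h : I → S → ℕ}

theorem antitone_fan (v : S ⊕ I) : Antitone (fan D h v) :=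
  fun _ _ hmn _ hx => ⟨hx.1, hx.2.1, hmn.trans hx.2.2⟩

theorem exists_notMem_fan (v : S ⊕ I) (x : I × S) : ∃ n, x ∉ fan D h v n :=
  ⟨h x.1 x.2 + 1, fun hx => (Nat.lt_succ_self _).not_ge hx.2.2⟩

theorem eq_of_mem_fan {v v' : S ⊕ I} {x : I × S} {m n : ℕ} (hne : v ≠ v') (hv : x ∈ fan D h v m)
    (hv' : x ∈ fan D h v' n) :
    (v = Sum.inl x.2 ∧ v' = Sum.inr x.1) ∨ (v = Sum.inr x.1 ∧ v' = Sum.inl x.2) := by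
  rcases hv.1 with h1 | h1 <;> rcases hv'.1 with h2 | h2
  · exact absurd (h1.trans h2.symm) hne
  · exact Or.inl ⟨h1, h2⟩
  · exact Or.inr ⟨h1, h2⟩
  · exact absurd (h1.trans h2.symm) hne

/-- Distinct points share at most one pair `(i, a)`, and it is gone after stage `h i a`. -/
theorem exists_disjoint_fan (v v' : S ⊕ I) (hne : v ≠ v') :
    ∃ n, Disjoint (fan D h v n) (fan D h v' n) := by
  by_cases hx : ∃ x, x ∈ fan D h v 0 ∧ x ∈ fan D h v' 0
  · obtain ⟨x, hx, hx'⟩ := hx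
    refine ⟨h x.1 x.2 + 1, Set.disjoint_left.2 fun y hy hy' => ?_⟩
    have hyx : y = x := by
      rcases eq_of_mem_fan hne hx hx' with ⟨rfl, rfl⟩ | ⟨rfl, rfl⟩ <;>
        rcases eq_of_mem_fan hne hy hy' with ⟨h1, h2⟩ | ⟨h1, h2⟩ <;>
        simp_all [Prod.ext_iff]
    subst hyx
    exact (Nat.lt_succ_self _).not_ge hy.2.2
  · exact ⟨0, Set.disjoint_left.2 fun x h1 h2 => hx ⟨x, h1, h2⟩⟩

/-- With the levels `G a + 1` and `ξ i + 1`, a shared pair `(i, a)` would have `h i a` above both `G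
a` and `ξ i`. -/
theorem Dominated.exists_shrink {I' : Set I} (hd : Dominated D h I') :
    ∃ f : S ⊕ I → ℕ, ∀ v v' x, v ≠ v' → x.1 ∈ I' → x ∈ fan D h v (f v) →
      x ∉ fan D h v' (f v') := by
  obtain ⟨G, hG⟩ := hd
  choose! ξ hξ using hG
  refine ⟨Sum.elim (fun a => G a + 1) fun i => ξ i + 1, fun v v' x hne hx hv hv' => ?_⟩
  have h1 := hξ _ hx _ hv.2.1
  have h2 := hv.2.2
  have h3 := hv'.2.2
  rw [le_max_iff] at h1
  rcases eq_of_mem_fan hne hv hv' with ⟨rfl, rfl⟩ | ⟨rfl, rfl⟩ <;>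
    simp only [Sum.elim_inl, Sum.elim_inr] at h2 h3 <;> lia

theorem dominated_of_disjoint (f : S ⊕ I → ℕ)
    (hf : ∀ v v', v ≠ v' → Disjoint (fan D h v (f v)) (fan D h v' (f v'))) :
    Dominated D h Set.univ := by
  refine ⟨fun a => f (Sum.inl a), fun i _ => ⟨f (Sum.inr i), fun a ha => ?_⟩⟩
  by_contra! hlt
  rw [max_lt_iff] at hlt
  exact Set.disjoint_left.1 (hf (Sum.inl a) (Sum.inr i) Sum.inl_ne_inr)
    (show (i, a) ∈ _ from ⟨Or.inl rfl, ha, hlt.1.le⟩) ⟨Or.inr rfl, ha, hlt.2.le⟩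

theorem mk_fan_lt (hμ : PowClosed μ) (hI : (#I : WithTop Cardinal.{u}) < μ)
    (hS : (#S : WithTop Cardinal.{u}) < μ) :
    (#((S ⊕ I) ⊕ I × S) : WithTop Cardinal.{u}) < μ := by
  have := hμ.add_lt (hμ.add_lt hS hI) (hμ.mul_lt hI hS)
  simpa [mk_sum, mk_prod] using this

theorem Incompact.exists_space (hμ : PowClosed μ) (h : Incompact lam μ) :
    ∃ (X : Type u) (_ : TopologicalSpace X), FirstCountableTopology X ∧ T2Space X ∧
      LtMetrizable X lam ∧ ¬ IsCWH (Set.univ : Set X) ∧ (#X : WithTop Cardinal.{u}) < μ := by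
  obtain ⟨I, S, D, h, -, hI, hS, hfree, hnot⟩ := h
  refine ⟨_, fanTopology (fan D h), firstCountableTopology_fan antitone_fan,
    t2Space_fan antitone_fan exists_notMem_fan exists_disjoint_fan, fun Y hY => ?_, fun hc => ?_,
    mk_fan_lt hμ hI hS⟩
  -- Overlaps matter only at isolated points of `Y`, and these involve fewer than `lam` functions.
  · obtain ⟨f, hf⟩ := (hfree (Prod.fst '' (Sum.inr ⁻¹' Y)) ((mk_image_le.trans
      (mk_preimage_of_injective _ _ Sum.inr_injective)).trans_lt hY)).exists_shrink
    exact metrizableSpace_fan antitone_fan exists_notMem_fan exists_disjoint_fan Y f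
      fun v v' x hne hx => hf v v' x hne ⟨x, hx, rfl⟩
  · obtain ⟨f, hf⟩ := exists_disjoint_of_isCWH_fan antitone_fan hc
    exact hnot (dominated_of_disjoint f hf)

theorem Incompact.exists_system (hμ : PowClosed μ) (h : Incompact lam μ) :
    ∃ (V : Type u) (U : V → ℕ → Set V), (∀ α n, U α (n + 1) ⊆ U α n) ∧
      ¬ SystemFreeOn U Set.univ ∧ (∀ v' : Set V, #v' < lam → SystemFreeOn U v') ∧
      (#V : WithTop Cardinal.{u}) < μ := by
  obtain ⟨I, S, D, h, -, hI, hS, hfree, hnot⟩ := h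
  refine ⟨(S ⊕ I) ⊕ I × S, fun x n => Sum.elim (fun v => Sum.inr '' fan D h v n) (fun _ => ∅) x,
    ?_, ?_, fun v' hv' => ?_, mk_fan_lt hμ hI hS⟩
  · rintro (v | x) n
    · exact Set.image_mono (antitone_fan v n.le_succ)
    · exact subset_rfl
  · rintro ⟨f, hf⟩
    refine hnot (dominated_of_disjoint (fun v => f (Sum.inl v)) fun v v' hne => ?_)
    exact (Set.disjoint_image_iff Sum.inr_injective).1
      (hf (Sum.inl v) trivial (Sum.inl v') trivial (Sum.inl_injective.ne hne))
  · obtain ⟨f, hf⟩ := (hfree ((fun i => Sum.inl (Sum.inr i)) ⁻¹' v')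
      ((mk_preimage_of_injective _ _ (Sum.inl_injective.comp Sum.inr_injective)).trans_lt
        hv')).exists_shrink
    refine ⟨Sum.elim f 0, ?_⟩
    rintro (v | x) hv (w | y) hw hne
    · refine (Set.disjoint_image_iff Sum.inr_injective).2 (Set.disjoint_left.2 fun x h1 h2 => ?_)
      have hne' : v ≠ w := fun h => hne (h ▸ rfl)
      refine hf v w x hne' ?_ h1 h2
      rcases eq_of_mem_fan hne' h1 h2 with ⟨rfl, rfl⟩ | ⟨rfl, rfl⟩
      · exact hw
      · exact hv
    · exact Set.disjoint_empty _
    · exact Set.empty_disjoint _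
    · exact Set.empty_disjoint _

end FromIncompact

/-! ### From spaces and systems to incompact families -/

section ToIncompact

open TopologicalSpace Topology Filter

variable {lam : Cardinal.{u}} {μ : WithTop Cardinal.{u}}

/-- Compactness for choice problems on a single set. -/
theorem exists_choice_of_not_incompact (hμ : PowClosed μ) (hlam : ℵ₀ ≤ lam)
    (hn : ¬ Incompact lam μ) {V : Type u} {A : V → V → Set (ℕ × ℕ)}
    (hA : ∀ x y, IsUpperSet (A x y)) (hV : (#V : WithTop Cardinal.{u}) < μ)
    (hsmall : ∀ V' : Set V, #V' < lam → ∃ f : V → ℕ, ∀ x ∈ V', ∀ y ∈ V', (f x, f y) ∈ A x y) :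
    ∃ f : V → ℕ, ∀ x y, (f x, f y) ∈ A x y := by
  by_contra hnot
  refine hn (incompact_of_choice hμ hlam hA hV (fun P' Z' hP hZ => ?_) ?_)
  · rw [lift_id, lift_id] at hZ
    obtain ⟨f, hf⟩ := hsmall (P' ∪ Z') ((mk_union_le _ _).trans_lt (add_lt_of_lt hlam hP hZ))
    exact ⟨f, f, fun p hp z hz => hf p (Or.inl hp) z (Or.inr hz)⟩
  -- The two sides may come with different functions; as the conditions are upper sets, their
  -- maximum serves for both.
  · rintro ⟨g, f, hgf⟩
    exact hnot ⟨fun x => max (g x) (f x), fun x y =>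
      hA x y (Prod.mk_le_mk.2 ⟨le_max_left _ _, le_max_right _ _⟩) (hgf x y)⟩

theorem incompact_of_system (hμ : PowClosed μ) (hlam : ℵ₀ ≤ lam) {V : Type u} {U : V → ℕ → Set V}
    (hU : ∀ α n, U α (n + 1) ⊆ U α n) (hnot : ¬ SystemFreeOn U Set.univ)
    (hsmall : ∀ v' : Set V, #v' < lam → SystemFreeOn U v') (hV : (#V : WithTop Cardinal.{u}) < μ) :
    Incompact lam μ := by
  by_contra hn
  have hanti : ∀ α, Antitone (U α) := fun α => antitone_nat_of_succ_le (hU α)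
  obtain ⟨f, hf⟩ := exists_choice_of_not_incompact hμ hlam hn
    (A := fun x y => {q | x ≠ y → Disjoint (U x q.1) (U y q.2)})
    (fun x y q q' hq h hne => (h hne).mono (hanti x hq.1) (hanti y hq.2)) hV fun v' hv' => by
      obtain ⟨f, hf⟩ := hsmall v' hv'
      exact ⟨f, hf⟩
  exact hnot ⟨f, fun x _ y _ => hf x y⟩

/-- A small set can be enlarged to a small set meeting countably many prescribed sets for each pair
of its points. -/
theorem exists_witness_set (hlam : ℵ₀ < lam) {X : Type u} {T : Type} [Countable T]
    (K : T → X → X → Set X) {V : Set X} (hV : #V < lam) :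
    ∃ Y : Set X, V ⊆ Y ∧ #Y < lam ∧ ∀ t, ∀ x ∈ V, ∀ y ∈ V, (K t x y).Nonempty →
      (K t x y ∩ Y).Nonempty := by
  classical
  let w : T × V × V → X := fun p =>
    if h : (K p.1 p.2.1 p.2.2).Nonempty then h.some else p.2.1
  refine ⟨V ∪ Set.range w, Set.subset_union_left, (mk_union_le _ _).trans_lt
    (add_lt_of_lt hlam.le hV (mk_range_le.trans_lt ?_)), fun t x hx y hy hne => ?_⟩
  · simp only [mk_prod, lift_id, lift_uzero]
    refine mul_lt_of_lt hlam.le (lt_of_le_of_lt ?_ hlam) (mul_lt_of_lt hlam.le hV hV)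
    rw [lift_le_aleph0]
    exact mk_le_aleph0
  · refine ⟨hne.some, hne.some_mem, Or.inr ⟨(t, ⟨x, hx⟩, ⟨y, hy⟩), ?_⟩⟩
    exact dif_pos hne

/-! ### Separation in subspaces -/

variable {X : Type u} [TopologicalSpace X]

/-- The traces of the sets `Z i` on the subspace `T` have disjoint open neighbourhoods in `T`. -/
def Separated {ι : Type*} (Z : ι → Set X) (T : Set X) : Prop :=
  ∃ U : ι → Set T, (∀ i, IsOpen (U i) ∧ Subtype.val ⁻¹' Z i ⊆ U i) ∧
    ∀ i j, i ≠ j → Disjoint (U i) (U j)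

/-- Separation amounts to choosing basic neighbourhoods that are disjoint within `Y` for points of
different `Z i`. For a small set of points, add a witness for every nonempty intersection of their
basic neighbourhoods in `Y`: neighbourhoods disjoint on the enlarged small set are then disjoint on
`Y`. -/
theorem incompact_of_separated [FirstCountableTopology X] (hμ : PowClosed μ) (hlam : ℵ₀ < lam)
    {ι : Type*} {Z : ι → Set X} (hZ : ∀ i j, i ≠ j → Disjoint (Z i) (Z j)) {Y : Set X}
    (hY : (#Y : WithTop Cardinal.{u}) < μ) (hsmall : ∀ T ⊆ Y, #T < lam → Separated Z T)
    (hnot : ¬ Separated Z Y) : Incompact lam μ := by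
  by_contra hn
  choose B hB using fun x : X => (𝓝 x).exists_antitone_basis
  have hA : ∀ x y : Y, IsUpperSet {q : ℕ × ℕ | ∀ i j, i ≠ j → (x : X) ∈ Z i → (y : X) ∈ Z j →
      B x q.1 ∩ B y q.2 ∩ Y = ∅} := by
    intro x y q q' hq h i j hij hx hy
    refine Set.subset_eq_empty ?_ (h i j hij hx hy)
    exact Set.inter_subset_inter_left _
      (Set.inter_subset_inter ((hB x).2 hq.1) ((hB y).2 hq.2))
  have key : ∃ f : Y → ℕ, ∀ x y : Y, ∀ i j, i ≠ j → (x : X) ∈ Z i → (y : X) ∈ Z j →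
      B x (f x) ∩ B y (f y) ∩ Y = ∅ := by
    refine exists_choice_of_not_incompact hμ hlam.le hn hA hY fun V' hV' => ?_
    obtain ⟨T, hVT, hT, hK⟩ := exists_witness_set hlam
      (fun (t : ℕ × ℕ) x y => B x t.1 ∩ B y t.2 ∩ Y) (V := Subtype.val '' V')
      (mk_image_le.trans_lt hV')
    have hVT' : Subtype.val '' V' ⊆ T ∩ Y := Set.subset_inter hVT (by
      rintro _ ⟨y, _, rfl⟩
      exact y.2)
    obtain ⟨U, hU, hd⟩ := hsmall (T ∩ Y) Set.inter_subset_right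
      ((mk_le_mk_of_subset Set.inter_subset_left).trans_lt hT)
    have hex : ∀ x : Y, ∃ n, x ∈ V' → ∀ i, (x : X) ∈ Z i → ∀ z : (T ∩ Y : Set X),
        (z : X) ∈ B x n → z ∈ U i := by
      intro x
      by_cases hx : x ∈ V' ∧ ∃ i, (x : X) ∈ Z i
      · obtain ⟨hxV, i, hi⟩ := hx
        have h1 := (hU i).1.mem_nhds ((hU i).2 (show (⟨x, hVT' ⟨x, hxV, rfl⟩⟩ : (T ∩ Y : Set X)) ∈ _
          from hi))
        rw [nhds_subtype, ((hB x).1.comap _).mem_iff] at h1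
        obtain ⟨n, -, hn⟩ := h1
        refine ⟨n, fun _ j hj z hz => ?_⟩
        obtain rfl : i = j := by
          by_contra hij
          exact Set.disjoint_left.1 (hZ i j hij) hi hj
        exact hn hz
      · exact ⟨0, fun hxV i hi => absurd ⟨hxV, i, hi⟩ hx⟩
    choose f hf using hex
    refine ⟨f, fun x hx y hy i j hij hi hj => ?_⟩
    by_contra hne
    obtain ⟨z, hz, hzT⟩ := hK (f x, f y) x ⟨x, hx, rfl⟩ y ⟨y, hy, rfl⟩
      (Set.nonempty_iff_ne_empty.2 hne)
    exact Set.disjoint_left.1 (hd i j hij) (hf x hx i hi ⟨z, hzT, hz.2⟩ hz.1.1)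
      (hf y hy j hj ⟨z, hzT, hz.2⟩ hz.1.2)
  obtain ⟨f, hf⟩ := key
  refine hnot ⟨fun i => ⋃ y : {y : Y // (y : X) ∈ Z i},
    interior (Subtype.val ⁻¹' B y.1 (f y.1)), fun i => ⟨isOpen_iUnion fun _ => isOpen_interior,
      fun y hy => Set.mem_iUnion.2 ⟨⟨y, hy⟩, ?_⟩⟩, fun i j hij => Set.disjoint_left.2 ?_⟩
  · exact mem_interior_iff_mem_nhds.2
      (continuous_subtype_val.continuousAt ((hB y).1.mem_of_mem trivial))
  · intro z h1 h2
    obtain ⟨x, hx⟩ := Set.mem_iUnion.1 h1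
    obtain ⟨y, hy⟩ := Set.mem_iUnion.1 h2
    have hx' : (z : X) ∈ B x.1 (f x.1) := interior_subset (s := Subtype.val ⁻¹' B x.1 (f x.1)) hx
    have hy' : (z : X) ∈ B y.1 (f y.1) := interior_subset (s := Subtype.val ⁻¹' B y.1 (f y.1)) hy
    exact (Set.eq_empty_iff_forall_notMem.1 (hf x.1 y.1 i j hij x.2 y.2)) z ⟨⟨hx', hy'⟩, z.2⟩

theorem incompact_of_ltCWH [FirstCountableTopology X] (hμ : PowClosed μ) (hlam : ℵ₀ < lam)
    (h : LtCWH X lam) {lam' : Cardinal.{u}} (hlam' : lam' ∈ interval lam μ)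
    (hnot : ¬ LeCWH X lam') : Incompact lam μ := by
  simp only [LeCWH, LtCWH, not_forall] at hnot
  obtain ⟨Y, hY, hnot⟩ := hnot
  simp only [IsCWH, not_forall] at hnot
  obtain ⟨D, hD, hnot⟩ := hnot
  refine incompact_of_separated (Z := fun d : D => {(d.1.1 : X)}) (Y := Y) hμ hlam
    (fun i j hij => Set.disjoint_singleton.2 fun h => hij (Subtype.ext (Subtype.ext h)))
    (coe_lt_of_le (Order.lt_succ_iff.1 hY) hlam'.2) (fun T hTY hT => ?_) ?_
  · let D' : Set T := {t | (⟨t, hTY t.2⟩ : Y) ∈ D}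
    have hD' : DiscreteTopology D' :=
      DiscreteTopology.of_continuous_injective
        (f := fun t : D' => (⟨⟨t.1.1, hTY t.1.2⟩, t.2⟩ : D)) (by fun_prop) fun a b h => by
          simpa [Subtype.ext_iff] using h
    obtain ⟨U, hU, hd⟩ := h T hT D' hD'
    refine ⟨fun d => ⋃ hd : d.1.1 ∈ T, U ⟨⟨d.1.1, hd⟩, d.2⟩, fun d =>
      ⟨isOpen_iUnion fun hd => (hU _).1, ?_⟩, fun d d' hne => Set.disjoint_left.2 fun t h1 h2 => ?_⟩
    · intro t (ht : t.1 = d.1.1)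
      have hdT : d.1.1 ∈ T := ht ▸ t.2
      obtain rfl : t = ⟨d.1.1, hdT⟩ := Subtype.ext ht
      exact Set.mem_iUnion.2 ⟨hdT, (hU _).2⟩
    · obtain ⟨hd1, h1⟩ := Set.mem_iUnion.1 h1
      obtain ⟨hd2, h2⟩ := Set.mem_iUnion.1 h2
      exact Set.disjoint_left.1 (hd _ _ fun h => hne (by simpa [Subtype.ext_iff] using h)) h1 h2
  · rintro ⟨U, hU, hd⟩
    exact hnot ⟨U, fun y => ⟨(hU y).1, (hU y).2 rfl⟩, hd⟩

theorem incompact_of_ltStarCWN [FirstCountableTopology X] (hμ : PowClosed μ) (hlam : ℵ₀ < lam)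
    (h : LtStarCWN X lam) {lam' : Cardinal.{u}} (hlam' : lam' ∈ interval lam μ)
    (hnot : ¬ LeStarCWN X lam') : Incompact lam μ := by
  simp only [LeStarCWN, LtStarCWN, not_forall] at hnot
  obtain ⟨Y, hY, hnot⟩ := hnot
  simp only [IsCWN, not_forall] at hnot
  obtain ⟨ι, Z, hdisj, hclopen, hnot⟩ := hnot
  refine incompact_of_separated (Z := fun i => Subtype.val '' Z i) (Y := Y) hμ hlam
    (fun i j hij => (Set.disjoint_image_iff Subtype.val_injective).2 (hdisj i j hij))
    (coe_lt_of_le (Order.lt_succ_iff.1 hY) hlam'.2) (fun T hTY hT => ?_) ?_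
  · let Z' : ι → Set T := fun i => {t | (⟨t, hTY t.2⟩ : Y) ∈ Z i}
    have hmem : ∀ t : (⋃ i, Z' i : Set T), (⟨t.1, hTY t.1.2⟩ : Y) ∈ ⋃ i, Z i := by
      rintro ⟨t, ht⟩
      obtain ⟨i, hi⟩ := Set.mem_iUnion.1 ht
      exact Set.mem_iUnion.2 ⟨i, hi⟩
    obtain ⟨U, hU, hd⟩ := h T hT ι Z' (fun i j hij => Set.disjoint_left.2 fun t h1 h2 =>
      Set.disjoint_left.1 (hdisj i j hij) h1 h2) fun i =>
        (hclopen i).preimage (show Continuous fun t : (⋃ i, Z' i : Set T) =>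
          (⟨⟨t.1, hTY t.1.2⟩, hmem t⟩ : (⋃ i, Z i : Set Y)) by fun_prop)
    refine ⟨U, fun i => ⟨(hU i).1, ?_⟩, hd⟩
    rintro t ⟨y, hy, hyt⟩
    refine (hU i).2 ?_
    obtain rfl : y = ⟨t, hTY t.2⟩ := Subtype.ext hyt
    exact hy
  · rintro ⟨U, hU, hd⟩
    refine hnot ⟨U, fun i => ⟨(hU i).1, fun y hy => (hU i).2 ⟨y, hy, rfl⟩⟩, hd⟩

end ToIncompact

/-! ### Metrizability from compactness -/

section Metrization

open TopologicalSpace Topology Filter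

variable {lam : Cardinal.{u}} {μ : WithTop Cardinal.{u}} {X : Type u} [TopologicalSpace X]

/-- A choice problem between `(x, k)` and `(y, n)`. In a metric subspace, shrink the neighbourhood
of `y` to radius `1 / (n + 1)` and let `g (x, k)` be so large that the ball of radius `2 / (g (x, k)
+ 1)` about `x` lies in `B x k`. Witnesses to failed inclusions lie in the subspace. -/
theorem exists_development (hμ : PowClosed μ) (hlam : ℵ₀ < lam) (hn : ¬ Incompact lam μ)
    (hX : (#X : WithTop Cardinal.{u}) < μ) (hm : LtMetrizable X lam) {B : X → ℕ → Set X}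
    (hB : ∀ x, (𝓝 x).HasAntitoneBasis (B x)) :
    ∃ f : X → ℕ → ℕ, ∀ x k, ∃ m, ∀ y n, m ≤ n → x ∈ B y (f y n) → B y (f y n) ⊆ B x k := by
  by_contra hnot
  have hA : ∀ p z : X × ℕ, IsUpperSet
      {q : ℕ × ℕ | q.1 ≤ z.2 → p.1 ∈ B z.1 q.2 → B z.1 q.2 ⊆ B p.1 p.2} := by
    intro p z q q' hq h h1 h2
    exact ((hB z.1).2 hq.2).trans (h (hq.1.trans h1) ((hB z.1).2 hq.2 h2))
  refine hn (incompact_of_choice hμ hlam.le hA ?_ (fun P Z hP hZ => ?_) ?_)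
  · have := hμ.mul_lt hX hμ.1
    simpa [mk_prod] using this
  · rw [lift_id, lift_id] at hZ
    obtain ⟨Y, hVY, hY, hK⟩ := exists_witness_set hlam
      (fun (t : ℕ × ℕ) x y => B y t.1 \ B x t.2) (V := Prod.fst '' P ∪ Prod.fst '' Z)
      ((mk_union_le _ _).trans_lt
        (add_lt_of_lt hlam.le (mk_image_le.trans_lt hP) (mk_image_le.trans_lt hZ)))
    have := hm Y hY
    let _ := metrizableSpaceMetric Y
    have hball : ∀ x : X, ∀ r > 0, ∃ n, ∀ hx : x ∈ Y, ∀ z : Y, (z : X) ∈ B x n →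
        dist z ⟨x, hx⟩ < r := by
      intro x r hr
      by_cases hx : x ∈ Y
      · have h1 := Metric.ball_mem_nhds (⟨x, hx⟩ : Y) hr
        rw [nhds_subtype, ((hB x).1.comap _).mem_iff] at h1
        obtain ⟨n, -, hn⟩ := h1
        exact ⟨n, fun _ z hz => hn hz⟩
      · exact ⟨0, fun h => absurd h hx⟩
    have hrad : ∀ p : X × ℕ, ∃ n : ℕ, ∀ hx : p.1 ∈ Y, ∀ z : Y,
        dist z ⟨p.1, hx⟩ < 2 * (1 / (n + 1 : ℝ)) → (z : X) ∈ B p.1 p.2 := by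
      intro p
      by_cases hx : p.1 ∈ Y
      · have h1 : (Subtype.val : Y → X) ⁻¹' B p.1 p.2 ∈ 𝓝 ⟨p.1, hx⟩ :=
          continuous_subtype_val.continuousAt ((hB p.1).1.mem_of_mem trivial)
        obtain ⟨r, hr, hsub⟩ := Metric.mem_nhds_iff.1 h1
        obtain ⟨n, hn⟩ := exists_nat_one_div_lt (half_pos hr)
        exact ⟨n, fun _ z hz => hsub (Metric.mem_ball.2 (hz.trans (by linarith)))⟩
      · exact ⟨0, fun h => absurd h hx⟩
    choose g hg using hrad
    choose f hf using fun z : X × ℕ => hball z.1 (1 / (z.2 + 1 : ℝ)) Nat.one_div_pos_of_nat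
    refine ⟨g, f, fun p hp z hz hle hmem => ?_⟩
    by_contra hsub
    have hpV : p.1 ∈ Prod.fst '' P ∪ Prod.fst '' Z := Or.inl ⟨p, hp, rfl⟩
    have hzV : z.1 ∈ Prod.fst '' P ∪ Prod.fst '' Z := Or.inr ⟨z, hz, rfl⟩
    obtain ⟨w, hw, hwY⟩ := hK (f z, p.2) p.1 hpV z.1 hzV (Set.sdiff_nonempty.2 hsub)
    refine hw.2 (hg p (hVY hpV) ⟨w, hwY⟩ ?_)
    have h1 := hf z (hVY hzV) ⟨w, hwY⟩ hw.1
    have h2 := hf z (hVY hzV) ⟨p.1, hVY hpV⟩ hmem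
    have h3 := dist_triangle_right (⟨w, hwY⟩ : Y) ⟨p.1, hVY hpV⟩ ⟨z.1, hVY hzV⟩
    have h4 : 1 / (z.2 + 1 : ℝ) ≤ 1 / (g p + 1) := Nat.one_div_le_one_div hle
    linarith
  · rintro ⟨g, f, hgf⟩
    exact hnot ⟨fun y n => f (y, n), fun x k => ⟨g (x, k), fun y n => hgf (x, k) (y, n)⟩⟩

/-- In a metric, if the ball of radius `r x` about `x` lies in `U x`, neighbourhoods of radius `r x
/ 4` work: when two of them meet, both lie in the full ball with the larger radius. -/
theorem exists_refinement (hμ : PowClosed μ) (hlam : ℵ₀ < lam) (hn : ¬ Incompact lam μ)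
    (hX : (#X : WithTop Cardinal.{u}) < μ) (hm : LtMetrizable X lam) {B : X → ℕ → Set X}
    (hB : ∀ x, (𝓝 x).HasAntitoneBasis (B x)) (U : X → Set X) (hU : ∀ x, U x ∈ 𝓝 x) :
    ∃ W : X → Set X, (∀ x, W x ∈ 𝓝 x) ∧
      ∀ x y, (W x ∩ W y).Nonempty → ∃ z, W x ∪ W y ⊆ U z := by
  have hA : ∀ x y : X, IsUpperSet {q : ℕ × ℕ | (B x q.1 ∩ B y q.2).Nonempty →
      B x q.1 ∪ B y q.2 ⊆ U x ∨ B x q.1 ∪ B y q.2 ⊆ U y} := by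
    intro x y q q' hq h hne
    have h1 := (hB x).2 hq.1
    have h2 := (hB y).2 hq.2
    exact (h (hne.mono (Set.inter_subset_inter h1 h2))).imp (Set.union_subset_union h1 h2).trans
      (Set.union_subset_union h1 h2).trans
  have key : ∃ f : X → ℕ, ∀ x y, (B x (f x) ∩ B y (f y)).Nonempty →
      B x (f x) ∪ B y (f y) ⊆ U x ∨ B x (f x) ∪ B y (f y) ⊆ U y := by
    refine exists_choice_of_not_incompact hμ hlam.le hn hA hX fun V hV => ?_
    obtain ⟨Y, hVY, hY, hK⟩ := exists_witness_set hlam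
      -- The first kind of witness shows that neighbourhoods meet, the second that one is not
      -- contained in `U y`.
      (fun (t : (ℕ × ℕ) ⊕ ℕ) x y => t.elim (fun p => B x p.1 ∩ B y p.2) fun i => B x i \ U y) hV
    have := hm Y hY
    let _ := metrizableSpaceMetric Y
    have hrad : ∀ x : X, ∃ r > 0, ∀ hx : x ∈ Y, ∀ z : Y, dist z ⟨x, hx⟩ < r → (z : X) ∈ U x := by
      intro x
      by_cases hx : x ∈ Y
      · have h1 : (Subtype.val : Y → X) ⁻¹' U x ∈ 𝓝 ⟨x, hx⟩ :=
          continuous_subtype_val.continuousAt (hU x)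
        obtain ⟨r, hr, hsub⟩ := Metric.mem_nhds_iff.1 h1
        exact ⟨r, hr, fun _ z hz => hsub hz⟩
      · exact ⟨1, one_pos, fun h => absurd h hx⟩
    choose r hr hrU using hrad
    have hball : ∀ x : X, ∃ n, ∀ hx : x ∈ Y, ∀ z : Y, (z : X) ∈ B x n →
        dist z ⟨x, hx⟩ < r x / 4 := by
      intro x
      by_cases hx : x ∈ Y
      · have h1 := Metric.ball_mem_nhds (⟨x, hx⟩ : Y) (show 0 < r x / 4 by linarith [hr x])
        rw [nhds_subtype, ((hB x).1.comap _).mem_iff] at h1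
        obtain ⟨n, -, hn⟩ := h1
        exact ⟨n, fun _ z hz => hn hz⟩
      · exact ⟨0, fun h => absurd h hx⟩
    choose f hf using hball
    have hsub : ∀ x ∈ V, ∀ y ∈ V, (B x (f x) ∩ B y (f y)).Nonempty → r y ≤ r x →
        B x (f x) ∪ B y (f y) ⊆ U x := by
      intro x hx y hy hne hle
      obtain ⟨w, hw, hwY⟩ := hK (Sum.inl (f x, f y)) x hx y hy hne
      have hwx := hf x (hVY hx) ⟨w, hwY⟩ hw.1
      have hwy := hf y (hVY hy) ⟨w, hwY⟩ hw.2
      refine Set.union_subset ?_ ?_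
      · by_contra h
        obtain ⟨z, hz, hzY⟩ := hK (Sum.inr (f x)) x hx x hx (Set.sdiff_nonempty.2 h)
        have h1 := hf x (hVY hx) ⟨z, hzY⟩ hz.1
        exact hz.2 (hrU x (hVY hx) ⟨z, hzY⟩ (by linarith [hr x]))
      · by_contra h
        obtain ⟨z, hz, hzY⟩ := hK (Sum.inr (f y)) y hy x hx (Set.sdiff_nonempty.2 h)
        have h1 := hf y (hVY hy) ⟨z, hzY⟩ hz.1
        have h2 := dist_triangle (⟨z, hzY⟩ : Y) ⟨y, hVY hy⟩ ⟨x, hVY hx⟩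
        have h3 := dist_triangle_left (⟨y, hVY hy⟩ : Y) ⟨x, hVY hx⟩ ⟨w, hwY⟩
        exact hz.2 (hrU x (hVY hx) ⟨z, hzY⟩ (by linarith [hr x]))
    refine ⟨f, fun x hx y hy hne => ?_⟩
    rcases le_total (r y) (r x) with hle | hle
    · exact Or.inl (hsub x hx y hy hne hle)
    · refine Or.inr ?_
      rw [Set.union_comm]
      exact hsub y hy x hx (by rwa [Set.inter_comm]) hle
  obtain ⟨f, hf⟩ := key
  exact ⟨fun x => B x (f x), fun x => (hB x).1.mem_of_mem trivial, fun x y hne =>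
    (hf x y hne).elim (fun h => ⟨x, h⟩) fun h => ⟨y, h⟩⟩

theorem incompact_of_ltMetrizable [FirstCountableTopology X] [T2Space X] (hμ : PowClosed μ)
    (hlam : ℵ₀ < lam) (hX : (#X : WithTop Cardinal.{u}) < μ) (hm : LtMetrizable X lam)
    (hnot : ¬ MetrizableSpace X) : Incompact lam μ := by
  by_contra hn
  choose B hB using fun x : X => (𝓝 x).exists_antitone_basis
  obtain ⟨f, hf⟩ := exists_development hμ hlam hn hX hm hB
  choose W hWn hW using fun U : {U : X → Set X // ∀ x, U x ∈ 𝓝 x} =>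
    exists_refinement hμ hlam hn hX hm hB U.1 U.2
  have hBn : ∀ x n, B x n ∈ 𝓝 x := fun x n => (hB x).1.mem_of_mem trivial
  -- Each assignment refines its predecessor, which gives the composition law, and lies inside the
  -- development, which makes the relations a neighbourhood base.
  let U : ℕ → {U : X → Set X // ∀ x, U x ∈ 𝓝 x} := fun n =>
    Nat.rec ⟨fun x => B x (f x 0), fun x => hBn x _⟩
      (fun n U => ⟨fun x => W U x ∩ B x (f x (n + 1)), fun x => inter_mem (hWn U x) (hBn x _)⟩) n
  have hUB : ∀ n x, (U n).1 x ⊆ B x (f x n) := by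
    rintro (_ | n) x
    · exact subset_rfl
    · exact Set.inter_subset_right
  have hUW : ∀ n x, (U (n + 1)).1 x ⊆ W (U n) x := fun n x => Set.inter_subset_left
  have : PseudoMetrizableSpace X := by
    refine pseudoMetrizableSpace_of_relations (fun n x y => ∃ z, x ∈ (U n).1 z ∧ y ∈ (U n).1 z)
      (fun n x => ⟨x, mem_of_mem_nhds ((U n).2 x), mem_of_mem_nhds ((U n).2 x)⟩)
      (fun n x y ⟨z, hx, hy⟩ => ⟨z, hy, hx⟩) ?_ fun x => ⟨fun s => ⟨fun hs => ?_, ?_⟩⟩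
    · rintro n x y w ⟨z, hx, hy⟩ ⟨z', hy', hw⟩
      obtain ⟨v, hv⟩ := hW (U n) z z' ⟨y, hUW n z hy, hUW n z' hy'⟩
      exact ⟨v, hv (Or.inl (hUW n z hx)), hv (Or.inr (hUW n z' hw))⟩
    · obtain ⟨k, -, hk⟩ := (hB x).1.mem_iff.1 hs
      obtain ⟨m, hm⟩ := hf x k
      refine ⟨m, trivial, ?_⟩
      rintro y ⟨z, hx, hy⟩
      exact hk (hm z m le_rfl (hUB m z hx) (hUB m z hy))
    · rintro ⟨n, -, hn⟩
      exact mem_of_superset ((U n).2 x) fun y hy => hn ⟨x, mem_of_mem_nhds ((U n).2 x), hy⟩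
  exact hnot inferInstance

end Metrization
end Freeness

/-! ### The equivalence, with (E) as the hub -/

theorem mainTheorem1 (lam : Cardinal.{u}) (μ : WithTop Cardinal.{u})
    (hlam : ℵ₀ ≤ lam) (hlt : (lam : WithTop Cardinal.{u}) < μ)
    (hμ : ∀ κ : Cardinal.{u}, (κ : WithTop Cardinal.{u}) < μ →
      ((κ ^ (ℵ₀ : Cardinal.{u}) : Cardinal.{u}) : WithTop Cardinal.{u}) < μ) :
    List.TFAE [
      -- (A)
      ∃ (X : Type u) (_ : TopologicalSpace X),
        FirstCountableTopology X ∧ T2Space X ∧ Freeness.LtMetrizable X lam ∧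
        ¬ TopologicalSpace.MetrizableSpace X ∧ (#X : WithTop Cardinal.{u}) < μ,
      -- (B)
      ∃ (X : Type u) (_ : TopologicalSpace X),
        FirstCountableTopology X ∧ T2Space X ∧ Freeness.LtCWH X lam ∧
        (∃ lam' ∈ Freeness.interval lam μ, ¬ Freeness.LeCWH X lam') ∧
        (#X : WithTop Cardinal.{u}) < μ,
      -- (B)⁺
      ∃ (X : Type u) (_ : TopologicalSpace X),
        FirstCountableTopology X ∧ T2Space X ∧ Freeness.LtCWH X lam ∧
        (∃ lam' ∈ Freeness.interval lam μ, ¬ Freeness.LeCWH X lam') ∧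
        (#X : WithTop Cardinal.{u}) < μ ∧ Freeness.LtMetrizable X lam,
      -- (C)
      ∃ (X : Type u) (_ : TopologicalSpace X),
        FirstCountableTopology X ∧ T2Space X ∧ Freeness.LtStarCWN X lam ∧
        (∃ lam' ∈ Freeness.interval lam μ, ¬ Freeness.LeStarCWN X lam') ∧
        (#X : WithTop Cardinal.{u}) < μ,
      -- (C)⁺
      ∃ (X : Type u) (_ : TopologicalSpace X),
        FirstCountableTopology X ∧ T2Space X ∧ Freeness.LtStarCWN X lam ∧
        (∃ lam' ∈ Freeness.interval lam μ, ¬ Freeness.LeStarCWN X lam') ∧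
        (#X : WithTop Cardinal.{u}) < μ ∧ Freeness.LtMetrizable X lam,
      -- (D)
      ∃ H : Set (Ordinal.{u} →. ℕ), (∀ h ∈ H, h.Dom.Countable) ∧
        Freeness.LtFree H lam ∧ ¬ Freeness.IsFree H ∧
        (∃ κ : Cardinal.{u}, Freeness.HasCard H κ ∧ (κ : WithTop Cardinal.{u}) < μ),
      -- (D)⁺
      ∃ H : Set (Ordinal.{u} →. ℕ), (∀ h ∈ H, h.Dom.Countable) ∧
        Freeness.LtFree H lam ∧ ¬ Freeness.IsFree H ∧
        (∃ κ : Cardinal.{u}, Freeness.HasCard H κ ∧ (κ : WithTop Cardinal.{u}) < μ) ∧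
        (∃ lam' ∈ Freeness.interval lam μ, ⋃ h ∈ H, h.Dom = Set.Iio lam'.ord) ∧
        (∀ h ∈ H, Freeness.OneToOne h),
      -- (D)', (D)'', (D)'''
      (Freeness.interval lam μ ∩ Freeness.SP).Nonempty,
      (Freeness.interval lam μ ∩ Freeness.SPw).Nonempty,
      (Freeness.interval lam μ ∩ Freeness.SPd).Nonempty,
      -- (E)
      ∃ (V : Type u) (U : V → ℕ → Set V), (∀ α n, U α (n + 1) ⊆ U α n) ∧
        ¬ Freeness.SystemFreeOn U Set.univ ∧
        (∀ v' : Set V, #v' < lam → Freeness.SystemFreeOn U v') ∧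
        (#V : WithTop Cardinal.{u}) < μ,
      -- (E)', (E)'', (E)'''
      (Freeness.interval lam μ ∩ Freeness.SQ).Nonempty,
      (Freeness.interval lam μ ∩ Freeness.SQw).Nonempty,
      (Freeness.interval lam μ ∩ Freeness.SQd).Nonempty] := by
  have hpow : Freeness.PowClosed μ := ⟨Freeness.coe_lt_of_le hlam hlt, hμ⟩
  -- Reduces the topological statements to uncountable `lam`.
  have hunc : ∀ {p : Prop}, (ℵ₀ < lam → p → Freeness.Incompact lam μ) → p →
      Freeness.Incompact lam μ := fun {p} h hp => by
    rcases hlam.eq_or_lt with rfl | hlam'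
    · exact Freeness.incompact_aleph0 hpow
    · exact h hlam' hp
  have hspace : Freeness.Incompact lam μ → ∃ (X : Type u) (_ : TopologicalSpace X),
      FirstCountableTopology X ∧ T2Space X ∧ Freeness.LtMetrizable X lam ∧
      ¬ TopologicalSpace.MetrizableSpace X ∧
      (∃ lam' ∈ Freeness.interval lam μ, ¬ Freeness.LeCWH X lam') ∧
      (#X : WithTop Cardinal.{u}) < μ := by
    intro h
    obtain ⟨X, tX, hfc, hT2, hm, hnot, hX⟩ := h.exists_space hpow
    -- With `max #X lam` as the larger cardinal, the whole space is one of the subspaces tested.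
    refine ⟨X, tX, hfc, hT2, hm, fun hmet =>
      hnot (Freeness.isCWN_of_metrizableSpace (Set.univ : Set X)).isCWH,
      ⟨max #X lam, ⟨le_max_right _ _, Freeness.coe_max_lt hX hlt⟩, fun h => hnot (h _ ?_)⟩, hX⟩
    rw [mk_univ]
    exact Order.lt_succ_of_le (le_max_left _ _)
  tfae_have 1 → 11 := fun h => by
    obtain ⟨V, hV⟩ := hunc (fun hlam' ⟨X, tX, hfc, hT2, hm, hnot, hX⟩ =>
      Freeness.incompact_of_ltMetrizable hpow hlam' hX hm hnot) h |>.exists_system hpow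
    exact ⟨V, hV⟩
  tfae_have 2 → 11 := fun h => hunc (fun hlam' ⟨X, tX, hfc, hT2, hc, ⟨_, hl, hnot⟩, hX⟩ =>
      Freeness.incompact_of_ltCWH hpow hlam' hc hl hnot) h |>.exists_system hpow
  tfae_have 3 → 2 := fun ⟨X, tX, h1, h2, h3, h4, h5, _⟩ => ⟨X, tX, h1, h2, h3, h4, h5⟩
  tfae_have 4 → 11 := fun h => hunc (fun hlam' ⟨X, tX, hfc, hT2, hc, ⟨_, hl, hnot⟩, hX⟩ =>
      Freeness.incompact_of_ltStarCWN hpow hlam' hc hl hnot) h |>.exists_system hpow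
  tfae_have 5 → 4 := fun ⟨X, tX, h1, h2, h3, h4, h5, _⟩ => ⟨X, tX, h1, h2, h3, h4, h5⟩
  tfae_have 6 → 11 := fun ⟨H, _, hfree, hnot, κ, hH, hκ⟩ =>
    (Freeness.incompact_of_ltFree hpow hlam hfree hnot hH hκ).exists_system hpow
  tfae_have 7 → 6 := fun ⟨H, h1, h2, h3, h4, _⟩ => ⟨H, h1, h2, h3, h4⟩
  tfae_have 8 → 9 := fun h => h.mono (Set.inter_subset_inter_right _ Freeness.SP_subset_SPw)
  tfae_have 9 → 11 := fun h => (Freeness.incompact_of_SPw hpow hlam h).exists_system hpow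
  tfae_have 10 → 8 := fun h => h.mono (Set.inter_subset_inter_right _ Freeness.SPd_subset_SP)
  tfae_have 10 → 14 := fun h => h.mono (Set.inter_subset_inter_right _ Freeness.SPd_subset_SQd)
  tfae_have 14 → 12 := fun h => h.mono (Set.inter_subset_inter_right _ Freeness.SQd_subset_SQ)
  tfae_have 12 → 13 := fun h => h.mono (Set.inter_subset_inter_right _ Freeness.SQ_subset_SQw)
  tfae_have 13 → 11 := fun h => (Freeness.incompact_of_SQw hpow hlam h).exists_system hpow
  have hinc : (∃ (V : Type u) (U : V → ℕ → Set V), (∀ α n, U α (n + 1) ⊆ U α n) ∧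
        ¬ Freeness.SystemFreeOn U Set.univ ∧
        (∀ v' : Set V, #v' < lam → Freeness.SystemFreeOn U v') ∧
        (#V : WithTop Cardinal.{u}) < μ) → Freeness.Incompact lam μ :=
    fun ⟨_, _, hU, hnot, hsmall, hV⟩ => Freeness.incompact_of_system hpow hlam hU hnot hsmall hV
  tfae_have 11 → 1 := fun h =>
    let ⟨X, tX, h1, h2, h3, h4, _, h6⟩ := hspace (hinc h)
    ⟨X, tX, h1, h2, h3, h4, h6⟩
  tfae_have 11 → 3 := fun h =>
    let ⟨X, tX, h1, h2, h3, _, h5, h6⟩ := hspace (hinc h)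
    ⟨X, tX, h1, h2, h3.ltStarCWN.ltCWH, h5, h6, h3⟩
  tfae_have 11 → 5 := fun h =>
    let ⟨X, tX, h1, h2, h3, _, ⟨κ, hκ, h5⟩, h6⟩ := hspace (hinc h)
    ⟨X, tX, h1, h2, h3.ltStarCWN, ⟨κ, hκ, fun h => h5 (Freeness.LtStarCWN.ltCWH h)⟩, h6, h3⟩
  tfae_have 11 → 7 := fun h => (hinc h).exists_oneToOne_family hpow hlt
  tfae_have 11 → 10 := fun h => (hinc h).nonempty_SPd hpow
  tfae_finish
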